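/- **Conventions.** Terms are taken up to renaming of bound variables and $\{\cdot/x\}$ denotes capture-avoiding substitution. When a term is moved below the binders of a list context, bound variables are renamed so that nothing is captured. $\to^*$ is the reflexive transitive closure of $\to$. **dBang.** Terms are given by $M,N ::= x \mid \lambda x M \mid MN \mid M[N/x] \mid {!M} \mid \mathrm{der}\,M$, where $M[N/x]$ (an explicit substitution) binds $x$ in $M$. List contexts are $L ::= \square \mid L[N/x]$. The reduction $\to$ is the closure under arbitrary contexts of $$L\langle\lambda x M\rangle N \to L\langle M[N/x]\rangle,\qquad M[L\langle !N\rangle/x]\to L\langle M\{N/x\}\rangle,\qquad \mathrm{der}(L\langle !M\rangle)\to L\langle M\rangle .$$ **Resource terms.** $m,n ::= x \mid \lambda x m \mid mn \mid m[n/x] \mid \mathrm{der}\,m \mid [m_1,\dots,m_k]$ with $k\ge 0$, where $[m_1,\dots,m_k]$ is a finite multiset; list contexts are $l ::= \square \mid l[n/x]$. Let $d_x(m)$ be the number of free occurrences of $x$ in $m$. Resource reduction relates a resource term to a resource term or to $\emptyset$; it is the closure under arbitrary contexts (with $\emptyset$ absorbing: if $m\to\emptyset$ then $c\langle m\rangle\to\emptyset$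 for every context $c$) of * $l\langle\lambda x m\rangle n\to l\langle m[n/x]\rangle$; * $m[l\langle[p_1,\dots,p_k]\rangle/x]\to l\langle m\{p_{\sigma(1)}/x_1,\dots,p_{\sigma(k)}/x_k\}\rangle$ for every permutation $\sigma$ of $\{1,\dots,k\}$, if $d_x(m)=k$ and $x_1,\dots,x_k$ are the free occurrences of $x$ in $m$; and $m[l\langle[p_1,\dots,p_k]\rangle/x]\to\emptyset$ if $d_x(m)\ne k$; * $\mathrm{der}(l\langle[m_1]\rangle)\to l\langle m_1\rangle$; and $\mathrm{der}(l\langle[m_1,\dots,m_k]\rangle)\to\emptyset$ if $k\neq 1$. A resource term is normal if it reduces neither to a term nor to $\emptyset$. For a set $X$ of resource terms, $\mathrm{nf}(X)$ is the set of normal resource terms $n$ such that $m\to^* n$ for some $m\in X$. **Taylor expansion.** The relation $m\triangleleft M$ is defined inductively: $x\triangleleft x$; if $m\triangleleft M$ and $n\triangleleft N$ then $\lambda x m\triangleleft\lambda x M$, $mn\triangleleft MN$, $m[n/x]\triangleleft M[N/x]$ and $\mathrm{der}\,m\triangleleft\mathrm{der}\,M$; and $[m_1,\dots,m_k]\triangleleft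 {!M}$ whenever $k\ge 0$ and $m_i\triangleleft M$ for all $i$. It extends to terms with an additional constant $\bot$, with no $m$ such that $m\triangleleft\bot$. Put $\mathcal T(M)=\{m\mid m\triangleleft M\}$. **Böhm trees.** Böhm approximants are the terms $A$ of the grammar $$\begin{aligned}A &::= \bot\mid x\mid\lambda x A\mid {!A}\mid A_\lambda A\mid \mathrm{der}\,A_!\mid A[A_!/x],\\ A_\lambda &::= x\mid {!A}\mid A_\lambda A\mid\mathrm{der}\,A_!\mid A_\lambda[A_!/x],\\ A_! &::= x\mid\lambda x A\mid A_\lambda A\mid\mathrm{der}\,A_!\mid A_![A_!/x].\end{aligned}$$ Write $A\sqsubseteq N$ if $A$ is obtained from the dBang term $N$ by replacing some subterms with $\bot$. The Böhm tree of $M$ is the set (an ideal) of the approximants of the reducts of $M$, $$\mathrm{BT}_!(M)=\{A \text{ a Böhm approximant}\mid \exists N,\ M\to^* N \text{ and } A\sqsubseteq N\},$$ and its Taylor expansion is $\mathcal T(\mathrm{BT}_!(M))=\bigcup_{A\in \mathrm{BT}_!(M)}\mathcal T(A)$. **Theorem (Commutation Theorem for dBang).** For every dBang term $M$, $$\mathcal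 T(\mathrm{BT}_!(M))=\mathrm{nf}(\mathcal T(M)).$$ -/

import Mathlib

/-! The distance Bang-calculus (terms up to renaming of bound variables, in de Bruijn notation),
its resource calculus, Taylor expansion and Böhm approximants. -/

namespace DBang

/-- The action of a renaming under one binder. -/
def liftRen (ρ : ℕ → ℕ) : ℕ → ℕ
  | 0 => 0
  | i + 1 => ρ i + 1

/-! ### Terms of dBang -/

/-- Terms `M, N ::= x | λx M | M N | M[N/x] | !M | der M`.
In `lam M` and in the explicit substitution `es M N` (that is, `M[N/x]`) the index `0` of `M`
is bound; `N` is outside the scope of that binder. -/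
inductive Term : Type
  | var (i : ℕ)
  | lam (M : Term)
  | app (M N : Term)
  | es (M N : Term)
  | bang (M : Term)
  | der (M : Term)

namespace Term

def rename : (ℕ → ℕ) → Term → Term
  | ρ, var i => var (ρ i)
  | ρ, lam M => lam (rename (liftRen ρ) M)
  | ρ, app M N => app (rename ρ M) (rename ρ N)
  | ρ, es M N => es (rename (liftRen ρ) M) (rename ρ N)
  | ρ, bang M => bang (rename ρ M)
  | ρ, der M => der (rename ρ M)

/-- The action of a simultaneous substitution under one binder. -/
def liftSub (σ : ℕ → Term) : ℕ → Term
  | 0 => var 0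
  | i + 1 => rename (· + 1) (σ i)

/-- Capture-avoiding simultaneous substitution. -/
def subst : (ℕ → Term) → Term → Term
  | σ, var i => σ i
  | σ, lam M => lam (subst (liftSub σ) M)
  | σ, app M N => app (subst σ M) (subst σ N)
  | σ, es M N => es (subst (liftSub σ) M) (subst σ N)
  | σ, bang M => bang (subst σ M)
  | σ, der M => der (subst σ M)

/-- `plug L M` is `L⟨M⟩` for a list context `L ::= □ | L[N/x]`; the head of the list is the
outermost explicit substitution, and `M` is in the scope of `L.length` binders. -/
def plug : List Term → Term → Term
  | [], M => M
  | N :: L, M => es (plug L M) N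

/-- The substitution `M{N/x}` performed below a list context with `k` binders: `N` already lives
below these binders, and the other free variables of `M` are moved below them. -/
def instBelow (k : ℕ) (N : Term) : ℕ → Term
  | 0 => N
  | i + 1 => var (i + k)

/-- One-step reduction of dBang: the three distant rules, closed under all contexts. -/
inductive Step : Term → Term → Prop
  /-- `L⟨λx M⟩ N → L⟨M[N/x]⟩` -/
  | beta (L : List Term) (M N : Term) :
      Step (app (plug L (lam M)) N) (plug L (es M (rename (· + L.length) N)))
  /-- `M[L⟨!N⟩/x] → L⟨M{N/x}⟩` -/
  | sub (L : List Term) (M N : Term) :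
      Step (es M (plug L (bang N))) (plug L (subst (instBelow L.length N) M))
  /-- `der (L⟨!M⟩) → L⟨M⟩` -/
  | derBang (L : List Term) (M : Term) :
      Step (der (plug L (bang M))) (plug L M)
  | lam {M M' : Term} : Step M M' → Step (lam M) (lam M')
  | appLeft {M M' : Term} (N : Term) : Step M M' → Step (app M N) (app M' N)
  | appRight (M : Term) {N N' : Term} : Step N N' → Step (app M N) (app M N')
  | esLeft {M M' : Term} (N : Term) : Step M M' → Step (es M N) (es M' N)
  | esRight (M : Term) {N N' : Term} : Step N N' → Step (es M N) (es M N')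
  | bang {M M' : Term} : Step M M' → Step (bang M) (bang M')
  | der {M M' : Term} : Step M M' → Step (der M) (der M')

/-- The reflexive transitive closure of `Step`. -/
def Steps : Term → Term → Prop := Relation.ReflTransGen Step

end Term

/-! ### Resource terms -/

/-- Resource terms `m, n ::= x | λx m | m n | m[n/x] | der m | [m₁, …, mₖ]` with the bags
`[m₁, …, mₖ]` written as lists. Bags are made into multisets in `RTerm`. -/
inductive RPre : Type
  | var (i : ℕ)
  | lam (m : RPre)
  | app (m n : RPre)
  | es (m n : RPre)
  | der (m : RPre)
  | bag (ms : List RPre)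

namespace RPre

/-- Equality up to the order of the elements of the bags, at any depth. -/
inductive PermEq : RPre → RPre → Prop
  | refl (m : RPre) : PermEq m m
  | symm {m n : RPre} : PermEq m n → PermEq n m
  | trans {m n p : RPre} : PermEq m n → PermEq n p → PermEq m p
  | lam {m m' : RPre} : PermEq m m' → PermEq (lam m) (lam m')
  | app {m m' n n' : RPre} : PermEq m m' → PermEq n n' → PermEq (app m n) (app m' n')
  | es {m m' n n' : RPre} : PermEq m m' → PermEq n n' → PermEq (es m n) (es m' n')
  | der {m m' : RPre} : PermEq m m' → PermEq (der m) (der m')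
  | bagCons {m m' : RPre} {ms ms' : List RPre} :
      PermEq m m' → PermEq (bag ms) (bag ms') → PermEq (bag (m :: ms)) (bag (m' :: ms'))
  | bagSwap (m n : RPre) (ms : List RPre) :
      PermEq (bag (m :: n :: ms)) (bag (n :: m :: ms))

instance instSetoid : Setoid RPre where
  r := PermEq
  iseqv := ⟨PermEq.refl, PermEq.symm, PermEq.trans⟩

def rename : (ℕ → ℕ) → RPre → RPre
  | ρ, var i => var (ρ i)
  | ρ, lam m => lam (rename (liftRen ρ) m)
  | ρ, app m n => app (rename ρ m) (rename ρ n)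
  | ρ, es m n => es (rename (liftRen ρ) m) (rename ρ n)
  | ρ, der m => der (rename ρ m)
  | ρ, bag ms => bag (ms.map fun m => rename ρ m)

/-- `deg x m` is `d_x(m)`, the number of free occurrences of the variable `x` in `m`. -/
def deg : ℕ → RPre → ℕ
  | x, var i => if i = x then 1 else 0
  | x, lam m => deg (x + 1) m
  | x, app m n => deg x m + deg x n
  | x, es m n => deg (x + 1) m + deg x n
  | x, der m => deg x m
  | x, bag ms => (ms.map fun m => deg x m).sum

/-- `plug l m` is `l⟨m⟩` for a resource list context `l ::= □ | l[n/x]`. -/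
def plug : List RPre → RPre → RPre
  | [], m => m
  | n :: l, m => es (plug l m) n

/-- Linear substitution: `LinSub x [p₁, …, pₖ] m m'` holds when `x` has exactly `k` free
occurrences `x₁, …, xₖ` in `m`, read from left to right, and `m' = m{p₁/x₁, …, pₖ/xₖ}`, where the
variable `x` is removed (the greater indices are decreased by one). -/
inductive LinSub : ℕ → List RPre → RPre → RPre → Prop
  | varEq (x : ℕ) (p : RPre) : LinSub x [p] (var x) p
  | varLt {x i : ℕ} : i < x → LinSub x [] (var i) (var i)
  | varGt {x i : ℕ} : x ≤ i → LinSub x [] (var (i + 1)) (var i)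
  | lam {x : ℕ} {ps : List RPre} {m m' : RPre} :
      LinSub (x + 1) (ps.map (rename (· + 1))) m m' → LinSub x ps (lam m) (lam m')
  | app {x : ℕ} {ps qs : List RPre} {m m' n n' : RPre} :
      LinSub x ps m m' → LinSub x qs n n' → LinSub x (ps ++ qs) (app m n) (app m' n')
  | es {x : ℕ} {ps qs : List RPre} {m m' n n' : RPre} :
      LinSub (x + 1) (ps.map (rename (· + 1))) m m' → LinSub x qs n n' →
        LinSub x (ps ++ qs) (es m n) (es m' n')
  | der {x : ℕ} {ps : List RPre} {m m' : RPre} :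
      LinSub x ps m m' → LinSub x ps (der m) (der m')
  | bagNil (x : ℕ) : LinSub x [] (bag []) (bag [])
  | bagCons {x : ℕ} {ps qs : List RPre} {m m' : RPre} {ms ms' : List RPre} :
      LinSub x ps m m' → LinSub x qs (bag ms) (bag ms') →
        LinSub x (ps ++ qs) (bag (m :: ms)) (bag (m' :: ms'))

/-- One-step resource reduction `m → n` to a term, closed under all contexts. -/
inductive Step : RPre → RPre → Prop
  /-- `l⟨λx m⟩ n → l⟨m[n/x]⟩` -/
  | beta (l : List RPre) (m n : RPre) :
      Step (app (plug l (lam m)) n) (plug l (es m (rename (· + l.length) n)))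
  /-- `m[l⟨[p₁, …, pₖ]⟩/x] → l⟨m{p_σ(1)/x₁, …, p_σ(k)/xₖ}⟩` for every permutation `σ`, where
  `x₁, …, xₖ` are the free occurrences of `x` in `m`; the other free variables of `m` are
  first moved below the binders of `l`. -/
  | sub (l : List RPre) {m m' : RPre} {ps qs : List RPre} :
      ps.Perm qs → LinSub 0 qs (rename (liftRen (· + l.length)) m) m' →
        Step (es m (plug l (bag ps))) (plug l m')
  /-- `der (l⟨[m]⟩) → l⟨m⟩` -/
  | derBag (l : List RPre) (m : RPre) :
      Step (der (plug l (bag [m]))) (plug l m)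
  | lam {m m' : RPre} : Step m m' → Step (lam m) (lam m')
  | appLeft {m m' : RPre} (n : RPre) : Step m m' → Step (app m n) (app m' n)
  | appRight (m : RPre) {n n' : RPre} : Step n n' → Step (app m n) (app m n')
  | esLeft {m m' : RPre} (n : RPre) : Step m m' → Step (es m n) (es m' n)
  | esRight (m : RPre) {n n' : RPre} : Step n n' → Step (es m n) (es m n')
  | der {m m' : RPre} : Step m m' → Step (der m) (der m')
  | bag (ms : List RPre) {m m' : RPre} (ns : List RPre) :
      Step m m' → Step (bag (ms ++ m :: ns)) (bag (ms ++ m' :: ns))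

/-- One-step resource reduction `m → ∅`, closed under all contexts (`∅` is absorbing). -/
inductive Vanish : RPre → Prop
  /-- `m[l⟨[p₁, …, pₖ]⟩/x] → ∅` if `d_x(m) ≠ k` -/
  | sub (l : List RPre) (m : RPre) (ps : List RPre) :
      deg 0 m ≠ ps.length → Vanish (es m (plug l (bag ps)))
  /-- `der (l⟨[m₁, …, mₖ]⟩) → ∅` if `k ≠ 1` -/
  | derBag (l ms : List RPre) : ms.length ≠ 1 → Vanish (der (plug l (bag ms)))
  | lam {m : RPre} : Vanish m → Vanish (lam m)
  | appLeft {m : RPre} (n : RPre) : Vanish m → Vanish (app m n)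
  | appRight (m : RPre) {n : RPre} : Vanish n → Vanish (app m n)
  | esLeft {m : RPre} (n : RPre) : Vanish m → Vanish (es m n)
  | esRight (m : RPre) {n : RPre} : Vanish n → Vanish (es m n)
  | der {m : RPre} : Vanish m → Vanish (der m)
  | bag (ms : List RPre) {m : RPre} (ns : List RPre) :
      Vanish m → Vanish (bag (ms ++ m :: ns))

/-- The resource approximation relation `m ◁ M` for a dBang term `M`. -/
inductive Approx : RPre → Term → Prop
  | var (i : ℕ) : Approx (var i) (Term.var i)
  | lam {m : RPre} {M : Term} : Approx m M → Approx (lam m) (Term.lam M)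
  | app {m n : RPre} {M N : Term} : Approx m M → Approx n N → Approx (app m n) (Term.app M N)
  | es {m n : RPre} {M N : Term} : Approx m M → Approx n N → Approx (es m n) (Term.es M N)
  | der {m : RPre} {M : Term} : Approx m M → Approx (der m) (Term.der M)
  | bag {ms : List RPre} {M : Term} : (∀ m ∈ ms, Approx m M) → Approx (bag ms) (Term.bang M)

end RPre

/-- Resource terms: bags are finite multisets. -/
def RTerm : Type := Quotient RPre.instSetoid

namespace RTerm

/-- The resource term denoted by an expression. -/
def mk (a : RPre) : RTerm := Quotient.mk RPre.instSetoid a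

/-- One-step resource reduction to a term. -/
def Step (m n : RTerm) : Prop := ∃ a b : RPre, mk a = m ∧ mk b = n ∧ RPre.Step a b

/-- One-step resource reduction to `∅`. -/
def Vanish (m : RTerm) : Prop := ∃ a : RPre, mk a = m ∧ RPre.Vanish a

/-- The reflexive transitive closure of `Step`. -/
def Steps : RTerm → RTerm → Prop := Relation.ReflTransGen Step

/-- A normal form reduces neither to a term nor to `∅`. -/
def Normal (m : RTerm) : Prop := (∀ n, ¬ Step m n) ∧ ¬ Vanish m

end RTerm

/-- The set of normal forms of the elements of a set of resource terms. -/
def nf (X : Set RTerm) : Set RTerm := {n | n.Normal ∧ ∃ m ∈ X, RTerm.Steps m n}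

/-- The Taylor expansion `T(M) = {m | m ◁ M}` of a dBang term. -/
def taylor (M : Term) : Set RTerm := {m | ∃ a : RPre, RTerm.mk a = m ∧ a.Approx M}

/-! ### Böhm approximants -/

/-- dBang terms extended with the constant `⊥`. -/
inductive PTerm : Type
  | bot
  | var (i : ℕ)
  | lam (A : PTerm)
  | app (A B : PTerm)
  | es (A B : PTerm)
  | bang (A : PTerm)
  | der (A : PTerm)

namespace PTerm

mutual

/-- Böhm approximants `A ::= ⊥ | x | λx A | !A | A_λ A | der A_! | A[A_!/x]`. -/
def IsApprox : PTerm → Prop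
  | bot => True
  | var _ => True
  | lam A => IsApprox A
  | bang A => IsApprox A
  | app A B => IsApproxNoLam A ∧ IsApprox B
  | der A => IsApproxNoBang A
  | es A B => IsApprox A ∧ IsApproxNoBang B

/-- Approximants that are neither `L⟨⊥⟩` nor `L⟨λx A⟩`:
`A_λ ::= x | !A | A_λ A | der A_! | A_λ[A_!/x]`. -/
def IsApproxNoLam : PTerm → Prop
  | bot => False
  | var _ => True
  | lam _ => False
  | bang A => IsApprox A
  | app A B => IsApproxNoLam A ∧ IsApprox B
  | der A => IsApproxNoBang A
  | es A B => IsApproxNoLam A ∧ IsApproxNoBang B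

/-- Approximants that are neither `L⟨⊥⟩` nor `L⟨!A⟩`:
`A_! ::= x | λx A | A_λ A | der A_! | A_![A_!/x]`. -/
def IsApproxNoBang : PTerm → Prop
  | bot => False
  | var _ => True
  | lam A => IsApprox A
  | bang _ => False
  | app A B => IsApproxNoLam A ∧ IsApprox B
  | der A => IsApproxNoBang A
  | es A B => IsApproxNoBang A ∧ IsApproxNoBang B

end

/-- `A ⊑ M`: `A` is obtained from the dBang term `M` by replacing subterms with `⊥`. -/
inductive Below : PTerm → Term → Prop
  | bot (M : Term) : Below bot M
  | var (i : ℕ) : Below (var i) (Term.var i)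
  | lam {A : PTerm} {M : Term} : Below A M → Below (lam A) (Term.lam M)
  | app {A B : PTerm} {M N : Term} : Below A M → Below B N → Below (app A B) (Term.app M N)
  | es {A B : PTerm} {M N : Term} : Below A M → Below B N → Below (es A B) (Term.es M N)
  | bang {A : PTerm} {M : Term} : Below A M → Below (bang A) (Term.bang M)
  | der {A : PTerm} {M : Term} : Below A M → Below (der A) (Term.der M)

/-- The resource approximation relation `m ◁ A`; nothing approximates `⊥`. -/
inductive Approx : RPre → PTerm → Prop
  | var (i : ℕ) : Approx (RPre.var i) (var i)
  | lam {m : RPre} {A : PTerm} : Approx m A → Approx (RPre.lam m) (lam A)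
  | app {m n : RPre} {A B : PTerm} : Approx m A → Approx n B → Approx (RPre.app m n) (app A B)
  | es {m n : RPre} {A B : PTerm} : Approx m A → Approx n B → Approx (RPre.es m n) (es A B)
  | der {m : RPre} {A : PTerm} : Approx m A → Approx (RPre.der m) (der A)
  | bag {ms : List RPre} {A : PTerm} : (∀ m ∈ ms, Approx m A) → Approx (RPre.bag ms) (bang A)

/-- The Taylor expansion `T(A) = {m | m ◁ A}`. -/
def taylor (A : PTerm) : Set RTerm := {m | ∃ a : RPre, RTerm.mk a = m ∧ Approx a A}

end PTerm

/-- The Böhm tree of `M`: the set (ideal) of the approximants of the reducts of `M`. -/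
def bohmTree (M : Term) : Set PTerm :=
  {A | A.IsApprox ∧ ∃ N : Term, Term.Steps M N ∧ A.Below N}

/-- The Taylor expansion of a Böhm tree: the union of those of its approximants. -/
def taylorTree (B : Set PTerm) : Set RTerm := ⋃ A ∈ B, A.taylor

end DBang

namespace DBang

-- From the Böhm tree to normal forms: let `a` approximate a Böhm approximant `A` below a reduct `N`
-- of `M`. Then `a` approximates `N`, and approximants can be pulled back along reduction:
-- `Approx.exists_of_step` finds, for each approximant of a reduct, an approximant of the source
-- reducing to it, collecting the copies of a substituted term into one bag. So `a` is a reduct of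
-- an element of the expansion of `M`. It is normal because the grammar of `A` keeps abstractions
-- and bags out of the head positions where they would form redexes.
--
-- Conversely, reducing an approximant of `M` destroys uniformity: one step acts on one element of a
-- bag, while a step of `M` acts on all of them. Hence the weaker relation `WApprox`, in which each
-- element of a bag may approximate its own reduct of the common body; it is preserved by every
-- resource step (`WApprox.step`). Once the resource term is normal, uniformity is recovered
-- (`WApprox.exists_approx`): the reducts chosen by the elements of a bag are joined by confluence,
-- and no approximation is lost on the way, since a normal approximant sees none of the redexes that
-- are contracted (`Approx.step`). The result is a reduct `N` of `M` that the normal term truly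
-- approximates. Cutting `N` at its remaining redexes gives the Böhm approximant `ofTerm N`, and the
-- normal term still approximates it.
--
-- Confluence of dBang is proved by the diamond property of a parallel reduction. Redexes at a
-- distance are handled by `Fire`, which crosses a list context one explicit substitution at a time;
-- the new critical pair, where a substitution crossed in this way is itself fired, is closed by
-- `Fire.comm`.

theorem liftRen_comp (f g : ℕ → ℕ) (i : ℕ) :
    liftRen f (liftRen g i) = liftRen (fun j => f (g j)) i := by
  cases i <;> rfl

namespace Term

/-! ### Renaming and substitution -/

theorem rename_rename (f g : ℕ → ℕ) (M : Term) :
    rename f (rename g M) = rename (fun i => f (g i)) M := by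
  induction M generalizing f g <;> simp_all [rename, liftRen_comp]

theorem liftSub_liftRen (σ : ℕ → Term) (ρ : ℕ → ℕ) (i : ℕ) :
    liftSub σ (liftRen ρ i) = liftSub (fun j => σ (ρ j)) i := by
  cases i <;> rfl

theorem subst_rename (σ : ℕ → Term) (ρ : ℕ → ℕ) (M : Term) :
    subst σ (rename ρ M) = subst (fun i => σ (ρ i)) M := by
  induction M generalizing σ ρ <;> simp_all [rename, subst, liftSub_liftRen]

theorem rename_liftSub (σ : ℕ → Term) (ρ : ℕ → ℕ) (i : ℕ) :
    rename (liftRen ρ) (liftSub σ i) = liftSub (fun j => rename ρ (σ j)) i := by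
  cases i <;> simp [liftSub, rename, rename_rename, liftRen]

theorem rename_subst (σ : ℕ → Term) (ρ : ℕ → ℕ) (M : Term) :
    rename ρ (subst σ M) = subst (fun i => rename ρ (σ i)) M := by
  induction M generalizing σ ρ <;> simp_all [rename, subst, rename_liftSub]

theorem subst_liftSub (σ τ : ℕ → Term) (i : ℕ) :
    subst (liftSub τ) (liftSub σ i) = liftSub (fun j => subst τ (σ j)) i := by
  cases i <;> simp [liftSub, subst, subst_rename, rename_subst]

theorem subst_subst (σ τ : ℕ → Term) (M : Term) :
    subst τ (subst σ M) = subst (fun i => subst τ (σ i)) M := by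
  induction M generalizing σ τ <;> simp_all [subst, subst_liftSub]

theorem liftSub_var_comp (ρ : ℕ → ℕ) :
    liftSub (fun i => var (ρ i)) = fun i => var (liftRen ρ i) := by
  funext i; cases i <;> rfl

theorem rename_eq_subst (ρ : ℕ → ℕ) (M : Term) :
    rename ρ M = subst (fun i => var (ρ i)) M := by
  induction M generalizing ρ <;> simp_all [rename, subst, liftSub_var_comp]

theorem rename_id (M : Term) : rename (fun i => i) M = M := by
  have h : liftRen (fun i => i) = fun i => i := by funext i; cases i <;> rfl
  induction M <;> simp_all [rename]

theorem subst_var (M : Term) : subst var M = M :=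
  (rename_eq_subst (fun i => i) M).symm.trans (rename_id M)

/-- Separates moving `M` below `k` binders from the substitution proper. The resource rule is stated
in this second form, so the two calculi can be compared. -/
theorem subst_instBelow (k : ℕ) (N M : Term) :
    subst (instBelow k N) M = subst (instBelow 0 N) (rename (liftRen (· + k)) M) := by
  rw [subst_rename]
  congr 1
  funext i
  cases i <;> rfl

/-! ### Redexes at a distance -/

/-- The context of the principal subterm of a redex: `□ N`, `M[□/x]` or `der □`. -/
inductive Op : Type
  | beta (N : Term)
  | sub (M : Term)
  | der

namespace Op

def rename (ρ : ℕ → ℕ) : Op → Op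
  | beta N => beta (N.rename ρ)
  | sub M => sub (M.rename (liftRen ρ))
  | der => der

def subst (σ : ℕ → Term) : Op → Op
  | beta N => beta (N.subst σ)
  | sub M => sub (M.subst (liftSub σ))
  | der => der

theorem rename_eq_subst (ρ : ℕ → ℕ) (o : Op) : o.rename ρ = o.subst (fun i => var (ρ i)) := by
  cases o <;> simp [rename, subst, Term.rename_eq_subst, liftSub_var_comp]

theorem rename_rename (f g : ℕ → ℕ) (o : Op) :
    (o.rename g).rename f = o.rename (fun i => f (g i)) := by
  cases o <;> simp [rename, Term.rename_rename, liftRen_comp]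

theorem subst_rename (σ : ℕ → Term) (ρ : ℕ → ℕ) (o : Op) :
    (o.rename ρ).subst σ = o.subst (fun i => σ (ρ i)) := by
  cases o <;> simp [rename, subst, Term.subst_rename, liftSub_liftRen]

theorem rename_subst (σ : ℕ → Term) (ρ : ℕ → ℕ) (o : Op) :
    (o.subst σ).rename ρ = o.subst (fun i => (σ i).rename ρ) := by
  cases o <;> simp [rename, subst, Term.rename_subst, rename_liftSub]

theorem subst_var (o : Op) : o.subst var = o := by
  have h : liftSub var = var := liftSub_var_comp (fun i => i) |>.trans (by
    funext i; cases i <;> rfl)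
  cases o <;> simp [subst, Term.subst_var, h]

/-- The term obtained by filling the context. -/
def wrap : Op → Term → Term
  | beta N, X => app X N
  | sub M, X => es M X
  | der, X => Term.der X

end Op

/-- `Fire o X Y`: the redex `o⟨X⟩` contracts to `Y`. -/
inductive Fire : Op → Term → Term → Prop
  | beta (N P : Term) : Fire (Op.beta N) (lam P) (es P N)
  | sub (M P : Term) : Fire (Op.sub M) (bang P) (subst (instBelow 0 P) M)
  | der (P : Term) : Fire Op.der (bang P) P
  | es {o : Op} {X Y : Term} (Q : Term) :
      Fire (o.rename (· + 1)) X Y → Fire o (es X Q) (es Y Q)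

/-- The operator and the term in its principal position leave no choice of contractum. This
identifies the results of two firings in the diamond property, and of `Fire` with the rules stated
through `plug`. -/
theorem Fire.functional {o : Op} {X Y Z : Term} (h : Fire o X Y) (h' : Fire o X Z) : Y = Z := by
  induction h generalizing Z with
  | beta | sub | der => cases h'; rfl
  | es Q _ ih => cases h' with | es _ h' => rw [ih h']

theorem subst_inst (σ : ℕ → Term) (P M : Term) :
    subst σ (subst (instBelow 0 P) M) =
      subst (instBelow 0 (subst σ P)) (subst (liftSub σ) M) := by
  rw [subst_subst, subst_subst]
  congr 1
  funext i
  cases i with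
  | zero => rfl
  | succ i =>
    simp only [instBelow, liftSub, subst, subst_rename, add_zero]
    exact (subst_var _).symm

theorem Fire.subst {o : Op} {X Y : Term} (h : Fire o X Y) (σ : ℕ → Term) :
    Fire (o.subst σ) (X.subst σ) (Y.subst σ) := by
  induction h generalizing σ with
  | beta N P => exact Fire.beta _ _
  | sub M P => rw [subst_inst]; exact Fire.sub _ _
  | der P => exact Fire.der _
  | es Q _ ih =>
    refine Fire.es _ ?_
    have := ih (liftSub σ)
    rw [Op.subst_rename] at this
    rwa [Op.rename_subst]

theorem Fire.rename {o : Op} {X Y : Term} (h : Fire o X Y) (ρ : ℕ → ℕ) :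
    Fire (o.rename ρ) (X.rename ρ) (Y.rename ρ) := by
  simpa only [Op.rename_eq_subst, rename_eq_subst] using h.subst fun i => var (ρ i)

/-- The critical pair of reduction at a distance: in `o⟨X[Q/x]⟩`, either the substitution fires, or
`o` fires across it with a redex in `X`. Neither order destroys the other redex, and both give the
same term. The induction is on the list context inside `Q`. -/
theorem Fire.comm {Q X X' Y : Term} {o : Op} (h : Fire (Op.sub X) Q X')
    (h' : Fire (o.rename (· + 1)) X Y) :
    ∃ Y', Fire (Op.sub Y) Q Y' ∧ Fire o X' Y' := by
  generalize hs : Op.sub X = s at h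
  induction h generalizing X Y o with
  | beta | der => cases hs
  | sub M P =>
    cases hs
    refine ⟨_, Fire.sub _ _, ?_⟩
    have := h'.subst (instBelow 0 P)
    rw [Op.subst_rename] at this
    convert this
    exact (Op.subst_var o).symm
  | es Q _ ih =>
    subst hs
    have h1 := h'.rename (liftRen (· + 1))
    -- The free variables of `o` avoid both binders, so inserting the new binder below or above the
    -- old one shifts them by two alike.
    have h2 : (o.rename (· + 1)).rename (liftRen (· + 1)) =
        (o.rename (· + 1)).rename (· + 1) := by
      rw [Op.rename_rename, Op.rename_rename]; rfl
    rw [h2] at h1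
    obtain ⟨Y', h3, h4⟩ := ih h1 rfl
    exact ⟨_, Fire.es _ h3, Fire.es _ h4⟩

theorem fire_beta_plug (L : List Term) (M N : Term) :
    Fire (Op.beta N) (plug L (lam M)) (plug L (es M (rename (· + L.length) N))) := by
  induction L generalizing N with
  | nil => simpa [plug, rename_id] using Fire.beta N M
  | cons Q L ih =>
    refine Fire.es _ ?_
    have := ih (rename (· + 1) N)
    rw [rename_rename] at this
    simpa [Op.rename, add_assoc, add_comm 1] using this

theorem fire_sub_plug (L : List Term) (M N : Term) :
    Fire (Op.sub M) (plug L (bang N)) (plug L (subst (instBelow L.length N) M)) := by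
  induction L generalizing M with
  | nil => exact Fire.sub M N
  | cons Q L ih =>
    refine Fire.es _ ?_
    have := ih (rename (liftRen (· + 1)) M)
    rw [subst_rename] at this
    rw [Op.rename]
    convert this using 3
    funext i
    cases i with
    | zero => rfl
    | succ i => simp only [instBelow, liftRen, List.length_cons]; congr 1; omega

theorem fire_der_plug (L : List Term) (M : Term) : Fire Op.der (plug L (bang M)) (plug L M) := by
  induction L with
  | nil => exact Fire.der M
  | cons Q L ih => exact Fire.es _ ih

/-- Only the shape of the redex is recorded: by `Fire.functional` the contractum follows. -/
theorem Fire.exists_plug {o : Op} {X Y : Term} (h : Fire o X Y) :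
    (∃ L M N, o = Op.beta N ∧ X = plug L (lam M)) ∨
    (∃ L M N, o = Op.sub M ∧ X = plug L (bang N)) ∨
    (∃ L M, o = Op.der ∧ X = plug L (bang M)) := by
  induction h with
  | beta N P => exact .inl ⟨[], P, N, rfl, rfl⟩
  | sub M P => exact .inr (.inl ⟨[], M, P, rfl, rfl⟩)
  | der P => exact .inr (.inr ⟨[], P, rfl, rfl⟩)
  | @es o X Y Q _ ih =>
    cases o <;> simp only [Op.rename, reduceCtorEq, false_and, exists_false, or_false, false_or,
      true_and, Op.beta.injEq, Op.sub.injEq] at ih ⊢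
    · obtain ⟨L, M, N, _, rfl⟩ := ih
      exact ⟨Q :: L, M, _, rfl, rfl⟩
    · obtain ⟨L, M, N, _, rfl⟩ := ih
      exact ⟨Q :: L, _, N, rfl, rfl⟩
    · obtain ⟨L, M, rfl⟩ := ih
      exact ⟨Q :: L, M, rfl⟩

theorem Fire.step {o : Op} {X Y : Term} (h : Fire o X Y) : Step (o.wrap X) Y := by
  rcases h.exists_plug with ⟨L, M, N, rfl, rfl⟩ | ⟨L, M, N, rfl, rfl⟩ | ⟨L, M, rfl, rfl⟩
  · rw [h.functional (fire_beta_plug L M N)]; exact Step.beta _ _ _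
  · rw [h.functional (fire_sub_plug L M N)]; exact Step.sub _ _ _
  · rw [h.functional (fire_der_plug L M)]; exact Step.derBang _ _

/-! ### Parallel reduction and confluence -/

/-- Parallel reduction, where a redex may be created by the reduction of its subterms. -/
inductive Par : Term → Term → Prop
  | var (i : ℕ) : Par (var i) (var i)
  | lam {M M' : Term} : Par M M' → Par (lam M) (lam M')
  | app {M M' N N' : Term} : Par M M' → Par N N' → Par (app M N) (app M' N')
  | es {M M' N N' : Term} : Par M M' → Par N N' → Par (es M N) (es M' N')
  | bang {M M' : Term} : Par M M' → Par (bang M) (bang M')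
  | der {M M' : Term} : Par M M' → Par (der M) (der M')
  | fireBeta {M M' N N' Y : Term} :
      Par M M' → Par N N' → Fire (Op.beta N') M' Y → Par (app M N) Y
  | fireSub {M M' N N' Y : Term} :
      Par M M' → Par N N' → Fire (Op.sub M') N' Y → Par (es M N) Y
  | fireDer {M M' Y : Term} : Par M M' → Fire Op.der M' Y → Par (der M) Y

theorem Par.refl (M : Term) : Par M M := by
  induction M with
  | var i => exact .var i
  | lam M ih => exact .lam ih
  | app M N ih ih' => exact .app ih ih'
  | es M N ih ih' => exact .es ih ih'
  | bang M ih => exact .bang ih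
  | der M ih => exact .der ih

theorem Par.rename {M N : Term} (h : Par M N) (ρ : ℕ → ℕ) : Par (M.rename ρ) (N.rename ρ) := by
  induction h generalizing ρ with
  | var i => exact .var _
  | lam _ ih => exact .lam (ih _)
  | app _ _ ih ih' => exact .app (ih _) (ih' _)
  | es _ _ ih ih' => exact .es (ih _) (ih' _)
  | bang _ ih => exact .bang (ih _)
  | der _ ih => exact .der (ih _)
  | fireBeta _ _ h ih ih' => exact .fireBeta (ih _) (ih' _) (h.rename ρ)
  | fireSub _ _ h ih ih' => exact .fireSub (ih _) (ih' _) (h.rename ρ)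
  | fireDer _ h ih => exact .fireDer (ih _) (h.rename ρ)

theorem par_liftSub {σ τ : ℕ → Term} (h : ∀ i, Par (σ i) (τ i)) (i : ℕ) :
    Par (liftSub σ i) (liftSub τ i) := by
  cases i with
  | zero => exact .var 0
  | succ i => exact (h i).rename _

theorem Par.subst {M N : Term} (h : Par M N) {σ τ : ℕ → Term} (hσ : ∀ i, Par (σ i) (τ i)) :
    Par (M.subst σ) (N.subst τ) := by
  induction h generalizing σ τ with
  | var i => exact hσ i
  | lam _ ih => exact .lam (ih (par_liftSub hσ))
  | app _ _ ih ih' => exact .app (ih hσ) (ih' hσ)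
  | es _ _ ih ih' => exact .es (ih (par_liftSub hσ)) (ih' hσ)
  | bang _ ih => exact .bang (ih hσ)
  | der _ ih => exact .der (ih hσ)
  | fireBeta _ _ h ih ih' => exact .fireBeta (ih hσ) (ih' hσ) (h.subst τ)
  | fireSub _ _ h ih ih' => exact .fireSub (ih (par_liftSub hσ)) (ih' hσ) (h.subst τ)
  | fireDer _ h ih => exact .fireDer (ih hσ) (h.subst τ)

/-- Parallel reduction of redex contexts. -/
inductive Op.Par : Op → Op → Prop
  | beta {N N' : Term} : Term.Par N N' → Op.Par (Op.beta N) (Op.beta N')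
  | sub {M M' : Term} : Term.Par M M' → Op.Par (Op.sub M) (Op.sub M')
  | der : Op.Par Op.der Op.der

theorem Op.Par.rename {o o' : Op} (h : Op.Par o o') (ρ : ℕ → ℕ) :
    Op.Par (o.rename ρ) (o'.rename ρ) := by
  cases h with
  | beta h => exact .beta (h.rename _)
  | sub h => exact .sub (h.rename _)
  | der => exact .der

/-- A redex survives parallel reduction of its parts. The only parallel step that alters the list
context at the root is the firing of one of its substitutions, which is the case settled by
`Fire.comm`. -/
theorem Fire.par {o o' : Op} {X X' Y : Term} (h : Fire o X Y) (hX : Par X X')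
    (ho : Op.Par o o') : ∃ Y', Fire o' X' Y' ∧ Par Y Y' := by
  induction h generalizing o' X' with
  | beta N P =>
    cases hX with | lam hP => cases ho with | beta hN => exact ⟨_, .beta _ _, .es hP hN⟩
  | sub M P =>
    cases hX with | bang hP => cases ho with | sub hM =>
    refine ⟨_, .sub _ _, hM.subst fun i => ?_⟩
    cases i with
    | zero => exact hP
    | succ i => exact .var _
  | der P => cases hX with | bang hP => cases ho with | der => exact ⟨_, .der _, hP⟩
  | es Q _ ih =>
    cases hX with
    | es hX hQ =>
      obtain ⟨Y', h1, h2⟩ := ih hX (ho.rename _)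
      exact ⟨_, .es _ h1, .es h2 hQ⟩
    | fireSub hX hQ hf =>
      obtain ⟨Y', h1, h2⟩ := ih hX (ho.rename _)
      obtain ⟨Z, h3, h4⟩ := hf.comm h1
      exact ⟨Z, h4, .fireSub h2 hQ h3⟩

/-- Join the immediate subterms first. If either side fired the root, `Fire.par` carries that firing
to the joined subterms; if both did, the two transported firings agree by functionality. -/
theorem Par.diamond {M N₁ N₂ : Term} (h₁ : Par M N₁) (h₂ : Par M N₂) :
    ∃ N, Par N₁ N ∧ Par N₂ N := by
  induction h₁ generalizing N₂ with
  | var i => exact ⟨_, h₂, .refl _⟩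
  | lam _ ih =>
    cases h₂ with | lam h => obtain ⟨N, a, b⟩ := ih h; exact ⟨_, .lam a, .lam b⟩
  | bang _ ih =>
    cases h₂ with | bang h => obtain ⟨N, a, b⟩ := ih h; exact ⟨_, .bang a, .bang b⟩
  | app _ _ ih ih' =>
    cases h₂ with
    | app h h' =>
      obtain ⟨N, a, b⟩ := ih h
      obtain ⟨N', a', b'⟩ := ih' h'
      exact ⟨_, .app a a', .app b b'⟩
    | fireBeta h h' f =>
      obtain ⟨N, a, b⟩ := ih h
      obtain ⟨N', a', b'⟩ := ih' h'
      obtain ⟨Y, c, d⟩ := f.par b (.beta b')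
      exact ⟨Y, .fireBeta a a' c, d⟩
  | fireBeta _ _ f ih ih' =>
    cases h₂ with
    | app h h' =>
      obtain ⟨N, a, b⟩ := ih h
      obtain ⟨N', a', b'⟩ := ih' h'
      obtain ⟨Y, c, d⟩ := f.par a (.beta a')
      exact ⟨Y, d, .fireBeta b b' c⟩
    | fireBeta h h' f' =>
      obtain ⟨N, a, b⟩ := ih h
      obtain ⟨N', a', b'⟩ := ih' h'
      obtain ⟨Y, c, d⟩ := f.par a (.beta a')
      obtain ⟨Y', c', d'⟩ := f'.par b (.beta b')
      cases c.functional c'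
      exact ⟨Y, d, d'⟩
  | es _ _ ih ih' =>
    cases h₂ with
    | es h h' =>
      obtain ⟨N, a, b⟩ := ih h
      obtain ⟨N', a', b'⟩ := ih' h'
      exact ⟨_, .es a a', .es b b'⟩
    | fireSub h h' f =>
      obtain ⟨N, a, b⟩ := ih h
      obtain ⟨N', a', b'⟩ := ih' h'
      obtain ⟨Y, c, d⟩ := f.par b' (.sub b)
      exact ⟨Y, .fireSub a a' c, d⟩
  | fireSub _ _ f ih ih' =>
    cases h₂ with
    | es h h' =>
      obtain ⟨N, a, b⟩ := ih h
      obtain ⟨N', a', b'⟩ := ih' h'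
      obtain ⟨Y, c, d⟩ := f.par a' (.sub a)
      exact ⟨Y, d, .fireSub b b' c⟩
    | fireSub h h' f' =>
      obtain ⟨N, a, b⟩ := ih h
      obtain ⟨N', a', b'⟩ := ih' h'
      obtain ⟨Y, c, d⟩ := f.par a' (.sub a)
      obtain ⟨Y', c', d'⟩ := f'.par b' (.sub b)
      cases c.functional c'
      exact ⟨Y, d, d'⟩
  | der _ ih =>
    cases h₂ with
    | der h => obtain ⟨N, a, b⟩ := ih h; exact ⟨_, .der a, .der b⟩
    | fireDer h f =>
      obtain ⟨N, a, b⟩ := ih h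
      obtain ⟨Y, c, d⟩ := f.par b .der
      exact ⟨Y, .fireDer a c, d⟩
  | fireDer _ f ih =>
    cases h₂ with
    | der h =>
      obtain ⟨N, a, b⟩ := ih h
      obtain ⟨Y, c, d⟩ := f.par a .der
      exact ⟨Y, d, .fireDer b c⟩
    | fireDer h f' =>
      obtain ⟨N, a, b⟩ := ih h
      obtain ⟨Y, c, d⟩ := f.par a .der
      obtain ⟨Y', c', d'⟩ := f'.par b .der
      cases c.functional c'
      exact ⟨Y, d, d'⟩

theorem Step.par {M N : Term} (h : Step M N) : Par M N := by
  induction h with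
  | beta L M N => exact .fireBeta (.refl _) (.refl _) (fire_beta_plug L M N)
  | sub L M N => exact .fireSub (.refl _) (.refl _) (fire_sub_plug L M N)
  | derBang L M => exact .fireDer (.refl _) (fire_der_plug L M)
  | lam _ ih => exact .lam ih
  | appLeft N _ ih => exact .app ih (.refl _)
  | appRight M _ ih => exact .app (.refl _) ih
  | esLeft N _ ih => exact .es ih (.refl _)
  | esRight M _ ih => exact .es (.refl _) ih
  | bang _ ih => exact .bang ih
  | der _ ih => exact .der ih

namespace Steps

theorem refl (M : Term) : Steps M M := Relation.ReflTransGen.refl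

theorem trans {M N P : Term} (h : Steps M N) (h' : Steps N P) : Steps M P :=
  Relation.ReflTransGen.trans h h'

theorem single {M N : Term} (h : Step M N) : Steps M N := Relation.ReflTransGen.single h

theorem lam {M M' : Term} (h : Steps M M') : Steps (Term.lam M) (Term.lam M') :=
  Relation.ReflTransGen.lift Term.lam (fun _ _ => Step.lam) _ _ h

theorem bang {M M' : Term} (h : Steps M M') : Steps (Term.bang M) (Term.bang M') :=
  Relation.ReflTransGen.lift Term.bang (fun _ _ => Step.bang) _ _ h

theorem der {M M' : Term} (h : Steps M M') : Steps (Term.der M) (Term.der M') :=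
  Relation.ReflTransGen.lift Term.der (fun _ _ => Step.der) _ _ h

theorem app {M M' N N' : Term} (h : Steps M M') (h' : Steps N N') :
    Steps (Term.app M N) (Term.app M' N') :=
  trans (Relation.ReflTransGen.lift (Term.app · N) (fun _ _ => Step.appLeft N) _ _ h)
    (Relation.ReflTransGen.lift (Term.app M') (fun _ _ => Step.appRight M') _ _ h')

theorem es {M M' N N' : Term} (h : Steps M M') (h' : Steps N N') :
    Steps (Term.es M N) (Term.es M' N') :=
  trans (Relation.ReflTransGen.lift (Term.es · N) (fun _ _ => Step.esLeft N) _ _ h)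
    (Relation.ReflTransGen.lift (Term.es M') (fun _ _ => Step.esRight M') _ _ h')

theorem plug (L : List Term) {M M' : Term} (h : Steps M M') :
    Steps (Term.plug L M) (Term.plug L M') := by
  induction L with
  | nil => exact h
  | cons N L ih => exact ih.es (refl N)

theorem exists_of_bang {M X : Term} (h : Steps (Term.bang M) X) :
    ∃ M', X = Term.bang M' ∧ Steps M M' := by
  induction h with
  | refl => exact ⟨M, rfl, refl M⟩
  | tail _ h ih =>
    obtain ⟨M', rfl, h'⟩ := ih
    cases h with | bang h => exact ⟨_, rfl, h'.trans (single h)⟩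

end Steps

theorem Par.steps {M N : Term} (h : Par M N) : Steps M N := by
  induction h with
  | var i => exact .refl _
  | lam _ ih => exact ih.lam
  | app _ _ ih ih' => exact ih.app ih'
  | es _ _ ih ih' => exact ih.es ih'
  | bang _ ih => exact ih.bang
  | der _ ih => exact ih.der
  | fireBeta _ _ f ih ih' => exact (ih.app ih').trans (.single f.step)
  | fireSub _ _ f ih ih' => exact (ih.es ih').trans (.single f.step)
  | fireDer _ f ih => exact ih.der.trans (.single f.step)

theorem steps_eq_reflTransGen_par : Steps = Relation.ReflTransGen Par := by
  funext M N
  refine propext ⟨fun h => Relation.ReflTransGen.mono (fun _ _ => Step.par) _ _ h, fun h => ?_⟩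
  induction h with
  | refl => exact .refl _
  | tail _ h ih => exact ih.trans h.steps

/-- Confluence of dBang. -/
theorem Steps.confluent {M N₁ N₂ : Term} (h₁ : Steps M N₁) (h₂ : Steps M N₂) :
    ∃ N, Steps N₁ N ∧ Steps N₂ N := by
  rw [steps_eq_reflTransGen_par] at *
  exact Relation.church_rosser (fun a b c hab hac =>
    let ⟨d, hb, hc⟩ := hab.diamond hac
    ⟨d, .single hb, .single hc⟩) h₁ h₂

theorem Steps.subst {M N : Term} (h : Steps M N) (σ : ℕ → Term) :
    Steps (M.subst σ) (N.subst σ) := by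
  induction h with
  | refl => exact .refl _
  | tail _ h ih => exact ih.trans (h.par.subst fun i => .refl (σ i)).steps

theorem Steps.rename {M N : Term} (h : Steps M N) (ρ : ℕ → ℕ) :
    Steps (M.rename ρ) (N.rename ρ) := by
  simpa only [rename_eq_subst] using h.subst fun i => var (ρ i)

end Term

end DBang

namespace DBang

namespace RPre

/-! ### Resource expressions -/

@[elab_as_elim]
-- `RPre` is nested through lists; the recursor's second motive is taken to be `P` on all elements
-- of the list.
theorem induct {P : RPre → Prop} (var : ∀ i, P (var i)) (lam : ∀ m, P m → P (lam m))
    (app : ∀ m n, P m → P n → P (app m n)) (es : ∀ m n, P m → P n → P (es m n))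
    (der : ∀ m, P m → P (der m)) (bag : ∀ ms, (∀ m ∈ ms, P m) → P (bag ms)) (m : RPre) : P m :=
  RPre.rec (motive_1 := P) (motive_2 := fun ms => ∀ m ∈ ms, P m) var lam app es der bag
    (fun _ h => nomatch h) (fun _ _ h h' => List.forall_mem_cons.2 ⟨h, h'⟩) m

theorem deg_rename {ρ : ℕ → ℕ} {x : ℕ} (m : RPre) (h : ∀ i, ρ i = x ↔ i = x) :
    deg x (rename ρ m) = deg x m := by
  have lift : ∀ {ρ : ℕ → ℕ} {x : ℕ}, (∀ i, ρ i = x ↔ i = x) →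
      ∀ i, liftRen ρ i = x + 1 ↔ i = x + 1 := by
    intro ρ x h i
    cases i <;> simp [liftRen, h]
  induction m using RPre.induct generalizing ρ x with
  | var i => simp [rename, deg, h]
  | lam m ih => simp [rename, deg, ih (lift h)]
  | app m n ih ih' => simp [rename, deg, ih h, ih' h]
  | es m n ih ih' => simp [rename, deg, ih (lift h), ih' h]
  | der m ih => simp [rename, deg, ih h]
  | bag ms ih =>
    simp only [rename, deg, List.map_map]
    congr 1
    exact List.map_congr_left fun m hm => ih m hm h

theorem deg_zero_rename_liftRen (ρ : ℕ → ℕ) (m : RPre) :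
    deg 0 (rename (liftRen ρ) m) = deg 0 m :=
  deg_rename m fun i => by cases i <;> simp [liftRen]

theorem exists_append_of_length {α : Type*} {l : List α} {a b : ℕ} (h : a + b = l.length) :
    ∃ l₁ l₂, l = l₁ ++ l₂ ∧ l₁.length = a ∧ l₂.length = b :=
  ⟨l.take a, l.drop a, (List.take_append_drop a l).symm, by simp; omega, by simp; omega⟩

/-- Arguments are consumed from left to right, so the list is cut according to the number of
occurrences in each subterm. This makes the two outcomes of a substitution redex exhaustive. -/
theorem LinSub.exists {x : ℕ} {m : RPre} {ps : List RPre} (h : deg x m = ps.length) :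
    ∃ m', LinSub x ps m m' := by
  induction m using RPre.induct generalizing x ps with
  | var i =>
    rw [deg] at h
    split_ifs at h with hi
    · obtain ⟨p, rfl⟩ := List.length_eq_one_iff.1 h.symm
      exact ⟨p, hi ▸ .varEq x p⟩
    · obtain rfl := List.length_eq_zero_iff.1 h.symm
      rcases lt_or_gt_of_ne hi with hi | hi
      · exact ⟨_, .varLt hi⟩
      · obtain ⟨j, rfl⟩ : ∃ j, i = j + 1 := ⟨i - 1, by omega⟩
        exact ⟨_, .varGt (by omega)⟩
  | lam m ih =>
    obtain ⟨m', hm⟩ := @ih (x + 1) (ps.map (rename (· + 1))) (by simpa [deg] using h)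
    exact ⟨_, .lam hm⟩
  | app m n ih ih' =>
    obtain ⟨l₁, l₂, rfl, h₁, h₂⟩ := exists_append_of_length (by simpa [deg] using h)
    obtain ⟨m', hm⟩ := ih h₁.symm
    obtain ⟨n', hn⟩ := ih' h₂.symm
    exact ⟨_, .app hm hn⟩
  | es m n ih ih' =>
    obtain ⟨l₁, l₂, rfl, h₁, h₂⟩ := exists_append_of_length (by simpa [deg] using h)
    obtain ⟨m', hm⟩ := @ih (x + 1) (l₁.map (rename (· + 1))) (by simpa using h₁.symm)
    obtain ⟨n', hn⟩ := ih' h₂.symm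
    exact ⟨_, .es hm hn⟩
  | der m ih =>
    obtain ⟨m', hm⟩ := ih (by simpa [deg] using h)
    exact ⟨_, .der hm⟩
  | bag ms ih =>
    -- The result must be known to be a bag for the induction on its elements to continue.
    suffices ∃ ms', LinSub x ps (bag ms) (bag ms') from let ⟨_, h⟩ := this; ⟨_, h⟩
    induction ms generalizing ps with
    | nil =>
      obtain rfl : ps = [] := List.length_eq_zero_iff.1 (by simpa [deg] using h.symm)
      exact ⟨_, .bagNil x⟩
    | cons m ms ihs =>
      obtain ⟨l₁, l₂, rfl, h₁, h₂⟩ := exists_append_of_length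
        (show deg x m + deg x (bag ms) = _ by simpa [deg] using h)
      obtain ⟨m', hm⟩ := ih m (by simp) h₁.symm
      obtain ⟨ms', hms⟩ := ihs (fun m hm => ih m (by simp [hm])) h₂.symm
      exact ⟨_, .bagCons hm hms⟩

-- Normal resource expressions

/-- A resource expression that reduces neither to a term nor to `∅`. -/
def Normal (m : RPre) : Prop := (∀ n, ¬ Step m n) ∧ ¬ Vanish m

namespace Normal

theorem lam {m : RPre} (h : Normal (RPre.lam m)) : Normal m :=
  ⟨fun _ s => h.1 _ (.lam s), fun v => h.2 (.lam v)⟩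

theorem appLeft {m n : RPre} (h : Normal (RPre.app m n)) : Normal m :=
  ⟨fun _ s => h.1 _ (.appLeft n s), fun v => h.2 (.appLeft n v)⟩

theorem appRight {m n : RPre} (h : Normal (RPre.app m n)) : Normal n :=
  ⟨fun _ s => h.1 _ (.appRight m s), fun v => h.2 (.appRight m v)⟩

theorem esLeft {m n : RPre} (h : Normal (RPre.es m n)) : Normal m :=
  ⟨fun _ s => h.1 _ (.esLeft n s), fun v => h.2 (.esLeft n v)⟩

theorem esRight {m n : RPre} (h : Normal (RPre.es m n)) : Normal n :=
  ⟨fun _ s => h.1 _ (.esRight m s), fun v => h.2 (.esRight m v)⟩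

theorem der {m : RPre} (h : Normal (RPre.der m)) : Normal m :=
  ⟨fun _ s => h.1 _ (.der s), fun v => h.2 (.der v)⟩

theorem bag {ms : List RPre} (h : Normal (RPre.bag ms)) {m : RPre} (hm : m ∈ ms) : Normal m := by
  obtain ⟨l₁, l₂, rfl⟩ := List.append_of_mem hm
  exact ⟨fun _ s => h.1 _ (.bag l₁ l₂ s), fun v => h.2 (.bag l₁ l₂ v)⟩

theorem app_ne {m n : RPre} (h : Normal (RPre.app m n)) (l : List RPre) (p : RPre) :
    m ≠ plug l (RPre.lam p) := by
  rintro rfl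
  exact h.1 _ (.beta l p n)

/-- Whatever the size of the bag, something fires: a linear substitution if the occurrences match,
annihilation otherwise. -/
theorem es_ne {m n : RPre} (h : Normal (RPre.es m n)) (l ps : List RPre) :
    n ≠ plug l (RPre.bag ps) := by
  rintro rfl
  by_cases hd : deg 0 m = ps.length
  · rw [← deg_zero_rename_liftRen (· + l.length)] at hd
    obtain ⟨m', hm⟩ := LinSub.exists hd
    exact h.1 _ (.sub l (.refl _) hm)
  · exact h.2 (.sub l m ps hd)

theorem der_ne {m : RPre} (h : Normal (RPre.der m)) (l ps : List RPre) :
    m ≠ plug l (RPre.bag ps) := by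
  rintro rfl
  by_cases hd : ps.length = 1
  · obtain ⟨p, rfl⟩ := List.length_eq_one_iff.1 hd
    exact h.1 _ (.derBag l p)
  · exact h.2 (.derBag l ps hd)

end Normal

theorem Approx.exists_plug {m : RPre} {L : List Term} {M : Term} (h : Approx m (Term.plug L M)) :
    ∃ l m', m = plug l m' ∧ List.Forall₂ Approx l L ∧ Approx m' M := by
  induction L generalizing m with
  | nil => exact ⟨[], m, rfl, .nil, h⟩
  | cons N L ih =>
    cases h with
    | es h h' =>
      obtain ⟨l, m', rfl, hl, hm⟩ := ih h
      exact ⟨_ :: l, m', rfl, .cons h' hl, hm⟩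

theorem Approx.plug {l : List RPre} {m : RPre} {L : List Term} {M : Term}
    (hl : List.Forall₂ Approx l L) (h : Approx m M) : Approx (RPre.plug l m) (Term.plug L M) := by
  induction hl with
  | nil => exact h
  | cons h' _ ih => exact .es ih h'

/-- The normal approximants of a term approximate its reducts. -/
theorem Approx.step {m : RPre} {M N : Term} (h : Approx m M) (hm : Normal m)
    (s : Term.Step M N) : Approx m N := by
  induction s generalizing m with
  | beta L M N =>
    cases h with
    | app h _ =>
      obtain ⟨l, _, rfl, _, ⟨⟩⟩ := h.exists_plug
      exact absurd rfl (hm.app_ne _ _)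
  | sub L M N =>
    cases h with
    | es _ h =>
      obtain ⟨l, _, rfl, _, ⟨⟩⟩ := h.exists_plug
      exact absurd rfl (hm.es_ne _ _)
  | derBang L M =>
    cases h with
    | der h =>
      obtain ⟨l, _, rfl, _, ⟨⟩⟩ := h.exists_plug
      exact absurd rfl (hm.der_ne _ _)
  | lam _ ih => cases h with | lam h => exact .lam (ih h hm.lam)
  | appLeft N _ ih => cases h with | app h h' => exact .app (ih h hm.appLeft) h'
  | appRight M _ ih => cases h with | app h h' => exact .app h (ih h' hm.appRight)
  | esLeft N _ ih => cases h with | es h h' => exact .es (ih h hm.esLeft) h'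
  | esRight M _ ih => cases h with | es h h' => exact .es h (ih h' hm.esRight)
  | bang _ ih => cases h with | bag h => exact .bag fun m h' => ih (h m h') (hm.bag h')
  | der _ ih => cases h with | der h => exact .der (ih h hm.der)

theorem Approx.steps {m : RPre} {M N : Term} (h : Approx m M) (hm : Normal m)
    (s : Term.Steps M N) : Approx m N := by
  induction s with
  | refl => exact h
  | tail _ s ih => exact ih.step hm s

/-! ### Approximation up to reduction -/

/-- `m` approximates `M` up to reductions of `M` that may differ between the elements of bags. -/
inductive WApprox : RPre → Term → Prop
  | var {M : Term} {i : ℕ} : Term.Steps M (Term.var i) → WApprox (var i) M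
  | lam {m : RPre} {M P : Term} : Term.Steps M (Term.lam P) → WApprox m P → WApprox (lam m) M
  | app {m n : RPre} {M P Q : Term} :
      Term.Steps M (Term.app P Q) → WApprox m P → WApprox n Q → WApprox (app m n) M
  | es {m n : RPre} {M P Q : Term} :
      Term.Steps M (Term.es P Q) → WApprox m P → WApprox n Q → WApprox (es m n) M
  | der {m : RPre} {M P : Term} : Term.Steps M (Term.der P) → WApprox m P → WApprox (der m) M
  | bag {ms : List RPre} {M P : Term} :
      Term.Steps M (Term.bang P) → (∀ m ∈ ms, WApprox m P) → WApprox (bag ms) M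

theorem Approx.wApprox {m : RPre} {M : Term} (h : Approx m M) : WApprox m M := by
  induction h with
  | var i => exact .var (.refl _)
  | lam _ ih => exact .lam (.refl _) ih
  | app _ _ ih ih' => exact .app (.refl _) ih ih'
  | es _ _ ih ih' => exact .es (.refl _) ih ih'
  | der _ ih => exact .der (.refl _) ih
  | bag _ ih => exact .bag (.refl _) ih

namespace WApprox

theorem of_steps {m : RPre} {M N : Term} (s : Term.Steps M N) (h : WApprox m N) :
    WApprox m M := by
  cases h with
  | var h => exact .var (s.trans h)
  | lam h h' => exact .lam (s.trans h) h'
  | app h h' h'' => exact .app (s.trans h) h' h''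
  | es h h' h'' => exact .es (s.trans h) h' h''
  | der h h' => exact .der (s.trans h) h'
  | bag h h' => exact .bag (s.trans h) h'

/-- Reducts of `!M` have the form `!P` with `P` a reduct of `M`, and reductions before the
approximation are absorbed by `of_steps`. -/
theorem bag_bang_iff {ms : List RPre} {M : Term} :
    WApprox (RPre.bag ms) (Term.bang M) ↔ ∀ m ∈ ms, WApprox m M := by
  refine ⟨fun h m hm => ?_, .bag (.refl _)⟩
  cases h with
  | bag h h' =>
    obtain ⟨P, ⟨⟩, s⟩ := h.exists_of_bang
    exact (h' m hm).of_steps s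

theorem bag_iff {ms : List RPre} {M : Term} :
    WApprox (RPre.bag ms) M ↔
      ∃ P, Term.Steps M (Term.bang P) ∧ WApprox (RPre.bag ms) (Term.bang P) := by
  refine ⟨fun h => ?_, fun ⟨P, h, h'⟩ => h'.of_steps h⟩
  cases h with
  | bag h h' => exact ⟨_, h, bag_bang_iff.2 h'⟩

theorem rename {m : RPre} {M : Term} (h : WApprox m M) (ρ : ℕ → ℕ) :
    WApprox (m.rename ρ) (M.rename ρ) := by
  induction h generalizing ρ with
  | var h => rw [RPre.rename]; exact .var (h.rename ρ)
  | lam h _ ih => rw [RPre.rename]; exact .lam (h.rename ρ) (ih _)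
  | app h _ _ ih ih' => rw [RPre.rename]; exact .app (h.rename ρ) (ih _) (ih' _)
  | es h _ _ ih ih' => rw [RPre.rename]; exact .es (h.rename ρ) (ih _) (ih' _)
  | der h _ ih => rw [RPre.rename]; exact .der (h.rename ρ) (ih _)
  | bag h _ ih =>
    rw [RPre.rename]
    exact .bag (h.rename ρ) (List.forall_mem_map.2 fun m hm => ih m hm ρ)

end WApprox

end RPre

-- Resource reduction preserves approximation up to reduction

namespace Term

/-- `σ` substitutes `σ x` for `x` and decreases the indices above `x`. -/
def IsInst (x : ℕ) (σ : ℕ → Term) : Prop :=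
  (∀ i, i < x → σ i = var i) ∧ ∀ i, x ≤ i → σ (i + 1) = var i

theorem IsInst.liftSub {x : ℕ} {σ : ℕ → Term} (h : IsInst x σ) :
    IsInst (x + 1) (liftSub σ) := by
  refine ⟨fun i hi => ?_, fun i hi => ?_⟩
  · cases i with
    | zero => rfl
    | succ i => rw [Term.liftSub, h.1 i (by omega), rename]
  · obtain ⟨j, rfl⟩ : ∃ j, i = j + 1 := ⟨i - 1, by omega⟩
    rw [Term.liftSub, h.2 j (by omega), rename]

theorem isInst_instBelow (N : Term) : IsInst 0 (instBelow 0 N) :=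
  ⟨fun _ h => absurd h (Nat.not_lt_zero _), fun _ _ => rfl⟩

end Term

namespace RPre

/-- The reductions stored in `hm` are stable under substitution, and each occurrence of `x` receives
its own approximant of `σ x`. -/
theorem LinSub.wApprox {x : ℕ} {ps : List RPre} {m m' : RPre} (h : LinSub x ps m m')
    {M : Term} (hm : WApprox m M) {σ : ℕ → Term} (hσ : Term.IsInst x σ)
    (hps : ∀ p ∈ ps, WApprox p (σ x)) : WApprox m' (M.subst σ) := by
  have lift : ∀ {ps : List RPre} {x : ℕ} {σ : ℕ → Term}, (∀ p ∈ ps, WApprox p (σ x)) →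
      ∀ p ∈ ps.map (rename (· + 1)), WApprox p (Term.liftSub σ (x + 1)) := fun h =>
    List.forall_mem_map.2 fun p hp => (h p hp).rename _
  induction h generalizing M σ with
  | varEq x p =>
    cases hm with | var h => exact (hps p (by simp)).of_steps (h.subst σ)
  | varLt hi =>
    cases hm with
    | var h => have := h.subst σ; rw [Term.subst, hσ.1 _ hi] at this; exact .var this
  | varGt hi =>
    cases hm with
    | var h => have := h.subst σ; rw [Term.subst, hσ.2 _ hi] at this; exact .var this
  | lam _ ih =>
    cases hm with | lam h h' => exact .lam (h.subst σ) (ih h' hσ.liftSub (lift hps))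
  | app _ _ ih ih' =>
    rw [List.forall_mem_append] at hps
    cases hm with
    | app h h₁ h₂ => exact .app (h.subst σ) (ih h₁ hσ hps.1) (ih' h₂ hσ hps.2)
  | es _ _ ih ih' =>
    rw [List.forall_mem_append] at hps
    cases hm with
    | es h h₁ h₂ => exact .es (h.subst σ) (ih h₁ hσ.liftSub (lift hps.1)) (ih' h₂ hσ hps.2)
  | der _ ih => cases hm with | der h h' => exact .der (h.subst σ) (ih h' hσ hps)
  | bagNil x => cases hm with | bag h h' => exact .bag (h.subst σ) (by simp)
  | bagCons _ _ ih ih' =>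
    rw [List.forall_mem_append] at hps
    -- One body `P` is fixed for the whole bag, so that the head and the tail are treated over the
    -- same term.
    obtain ⟨P, h, h'⟩ := WApprox.bag_iff.1 hm
    rw [WApprox.bag_bang_iff, List.forall_mem_cons] at h'
    refine (WApprox.bag_bang_iff.2 ?_).of_steps (h.subst σ)
    exact List.forall_mem_cons.2 ⟨ih h'.1 hσ hps.1,
      WApprox.bag_bang_iff.1 (ih' (WApprox.bag_bang_iff.2 h'.2) hσ hps.2)⟩

namespace WApprox

theorem permEq_iff {m n : RPre} (h : PermEq m n) (M : Term) : WApprox m M ↔ WApprox n M := by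
  induction h generalizing M with
  | refl => rfl
  | symm _ ih => exact (ih M).symm
  | trans _ _ ih ih' => exact (ih M).trans (ih' M)
  | lam _ ih =>
    refine ⟨fun h => ?_, fun h => ?_⟩
    · cases h with | lam s h => exact .lam s ((ih _).1 h)
    · cases h with | lam s h => exact .lam s ((ih _).2 h)
  | app _ _ ih ih' =>
    refine ⟨fun h => ?_, fun h => ?_⟩
    · cases h with | app s h h' => exact .app s ((ih _).1 h) ((ih' _).1 h')
    · cases h with | app s h h' => exact .app s ((ih _).2 h) ((ih' _).2 h')
  | es _ _ ih ih' =>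
    refine ⟨fun h => ?_, fun h => ?_⟩
    · cases h with | es s h h' => exact .es s ((ih _).1 h) ((ih' _).1 h')
    · cases h with | es s h h' => exact .es s ((ih _).2 h) ((ih' _).2 h')
  | der _ ih =>
    refine ⟨fun h => ?_, fun h => ?_⟩
    · cases h with | der s h => exact .der s ((ih _).1 h)
    · cases h with | der s h => exact .der s ((ih _).2 h)
  | bagCons _ _ ih ih' =>
    rw [bag_iff, @bag_iff (_ :: _)]
    simp only [bag_bang_iff, List.forall_mem_cons] at ih' ⊢
    refine exists_congr fun P => and_congr_right fun _ => and_congr (ih P) ?_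
    simpa only [bag_bang_iff] using ih' (Term.bang P)
  | bagSwap m n ms =>
    rw [bag_iff, @bag_iff (_ :: _)]
    simp only [bag_bang_iff, List.forall_mem_cons]
    exact exists_congr fun P => and_congr_right fun _ => and_left_comm

theorem exists_plug {l : List RPre} {m : RPre} {M : Term} (h : WApprox (RPre.plug l m) M) :
    ∃ L P, List.Forall₂ WApprox l L ∧ Term.Steps M (Term.plug L P) ∧ WApprox m P := by
  induction l generalizing M with
  | nil => exact ⟨[], M, .nil, .refl _, h⟩
  | cons n l ih =>
    cases h with
    | es s h h' =>
      obtain ⟨L, P, hl, s', hm⟩ := ih h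
      exact ⟨_ :: L, P, .cons h' hl, s.trans (s'.es (.refl _)), hm⟩

theorem plug {l : List RPre} {m : RPre} {L : List Term} {M : Term}
    (hl : List.Forall₂ WApprox l L) (h : WApprox m M) :
    WApprox (RPre.plug l m) (Term.plug L M) := by
  induction hl with
  | nil => exact h
  | cons h' _ ih => exact .es (.refl _) ih h'

/-- Approximation up to reduction is preserved by resource reduction. -/
theorem step {m n : RPre} (s : Step m n) {M : Term} (h : WApprox m M) : WApprox n M := by
  induction s generalizing M with
  | beta l m n =>
    cases h with
    | app s h h' =>
      obtain ⟨L, P, hl, s', hm⟩ := h.exists_plug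
      cases hm with
      | lam s'' hm =>
        refine of_steps (s.trans (((s'.trans (s''.plug L)).app (.refl _)).trans
          (.single (.beta _ _ _)))) (.plug hl (.es (.refl _) hm ?_))
        rw [hl.length_eq]
        exact h'.rename _
  | sub l hp hs =>
    cases h with
    | es s h h' =>
      obtain ⟨L, P, hl, s', hm⟩ := h'.exists_plug
      cases hm with
      | bag s'' hm =>
        refine of_steps (s.trans (((Term.Steps.refl _).es (s'.trans (s''.plug L))).trans
          (.single (.sub _ _ _)))) (.plug hl ?_)
        rw [Term.subst_instBelow, ← hl.length_eq]
        -- Which element goes to which occurrence is immaterial, since all of them approximate the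
        -- same term.
        exact hs.wApprox (h.rename _) (Term.isInst_instBelow _)
          fun p hq => hm p (hp.mem_iff.2 hq)
  | derBag l m =>
    cases h with
    | der s h =>
      obtain ⟨L, P, hl, s', hm⟩ := h.exists_plug
      cases hm with
      | bag s'' hm =>
        exact of_steps (s.trans ((s'.trans (s''.plug L)).der.trans
          (.single (.derBang _ _)))) (.plug hl (hm m (by simp)))
  | lam _ ih => cases h with | lam s h => exact .lam s (ih h)
  | appLeft n _ ih => cases h with | app s h h' => exact .app s (ih h) h'
  | appRight m _ ih => cases h with | app s h h' => exact .app s h (ih h')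
  | esLeft n _ ih => cases h with | es s h h' => exact .es s (ih h) h'
  | esRight m _ ih => cases h with | es s h h' => exact .es s h (ih h')
  | der _ ih => cases h with | der s h => exact .der s (ih h)
  | bag ms ns _ ih =>
    cases h with
    | bag s h =>
      refine .bag s ?_
      simp only [List.forall_mem_append, List.forall_mem_cons] at h ⊢
      exact ⟨h.1, ih h.2.1, h.2.2⟩

/-- For normal approximants, the reductions of the elements of bags can be joined. -/
theorem exists_approx {m : RPre} {M : Term} (h : WApprox m M) (hm : Normal m) :
    ∃ N, Term.Steps M N ∧ Approx m N := by
  induction h with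
  | var s => exact ⟨_, s, .var _⟩
  | lam s _ ih =>
    obtain ⟨N, s', h⟩ := ih hm.lam
    exact ⟨_, s.trans s'.lam, .lam h⟩
  | app s _ _ ih ih' =>
    obtain ⟨N, s', h⟩ := ih hm.appLeft
    obtain ⟨N', s'', h'⟩ := ih' hm.appRight
    exact ⟨_, s.trans (s'.app s''), .app h h'⟩
  | es s _ _ ih ih' =>
    obtain ⟨N, s', h⟩ := ih hm.esLeft
    obtain ⟨N', s'', h'⟩ := ih' hm.esRight
    exact ⟨_, s.trans (s'.es s''), .es h h'⟩
  | der s _ ih =>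
    obtain ⟨N, s', h⟩ := ih hm.der
    exact ⟨_, s.trans s'.der, .der h⟩
  | @bag ms M P s _ ih =>
    have hn : ∀ m ∈ ms, Normal m := fun m h => hm.bag h
    suffices ∃ N, Term.Steps P N ∧ ∀ m ∈ ms, Approx m N from
      let ⟨N, s', h⟩ := this; ⟨_, s.trans s'.bang, .bag h⟩
    clear hm s
    induction ms with
    | nil => exact ⟨P, .refl P, by simp⟩
    | cons m ms ihs =>
      rw [List.forall_mem_cons] at hn
      obtain ⟨N₁, s₁, h₁⟩ := ih m (by simp) hn.1
      obtain ⟨N₂, s₂, h₂⟩ := ihs (fun m h => by simp_all) (fun m h => ih m (by simp [h])) hn.2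
      -- The reducts found for the head and for the tail are joined here; normality lets both
      -- approximations persist up to `N`.
      obtain ⟨N, t₁, t₂⟩ := s₁.confluent s₂
      exact ⟨N, s₁.trans t₁, List.forall_mem_cons.2
        ⟨h₁.steps hn.1 t₁, fun m h => (h₂ m h).steps (hn.2 m h) t₂⟩⟩

end WApprox

end RPre

end DBang

namespace DBang

namespace RPre

/-! ### Expansion: the approximants of a reduct are reducts of approximants -/

/-- The reflexive transitive closure of `Step`. -/
def Steps : RPre → RPre → Prop := Relation.ReflTransGen Step

namespace Steps

theorem refl (m : RPre) : Steps m m := Relation.ReflTransGen.refl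

theorem trans {m n p : RPre} (h : Steps m n) (h' : Steps n p) : Steps m p :=
  Relation.ReflTransGen.trans h h'

theorem single {m n : RPre} (h : Step m n) : Steps m n := Relation.ReflTransGen.single h

theorem lam {m m' : RPre} (h : Steps m m') : Steps (RPre.lam m) (RPre.lam m') :=
  Relation.ReflTransGen.lift RPre.lam (fun _ _ => Step.lam) _ _ h

theorem der {m m' : RPre} (h : Steps m m') : Steps (RPre.der m) (RPre.der m') :=
  Relation.ReflTransGen.lift RPre.der (fun _ _ => Step.der) _ _ h

theorem appLeft {m m' : RPre} (n : RPre) (h : Steps m m') :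
    Steps (RPre.app m n) (RPre.app m' n) :=
  Relation.ReflTransGen.lift (RPre.app · n) (fun _ _ => Step.appLeft n) _ _ h

theorem appRight (m : RPre) {n n' : RPre} (h : Steps n n') :
    Steps (RPre.app m n) (RPre.app m n') :=
  Relation.ReflTransGen.lift (RPre.app m) (fun _ _ => Step.appRight m) _ _ h

theorem esLeft {m m' : RPre} (n : RPre) (h : Steps m m') :
    Steps (RPre.es m n) (RPre.es m' n) :=
  Relation.ReflTransGen.lift (RPre.es · n) (fun _ _ => Step.esLeft n) _ _ h

theorem esRight (m : RPre) {n n' : RPre} (h : Steps n n') :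
    Steps (RPre.es m n) (RPre.es m n') :=
  Relation.ReflTransGen.lift (RPre.es m) (fun _ _ => Step.esRight m) _ _ h

theorem bagAppend (ns : List RPre) {ms ms' : List RPre} (h : List.Forall₂ Steps ms ms') :
    Steps (RPre.bag (ns ++ ms)) (RPre.bag (ns ++ ms')) := by
  induction h generalizing ns with
  | nil => exact refl _
  | @cons m m' ms ms' h _ ih =>
    refine trans (Relation.ReflTransGen.lift (fun m => RPre.bag (ns ++ m :: ms))
      (fun _ _ => Step.bag ns ms) _ _ h) ?_
    simpa using ih (ns ++ [m'])

theorem bag {ms ms' : List RPre} (h : List.Forall₂ Steps ms ms') :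
    Steps (RPre.bag ms) (RPre.bag ms') :=
  bagAppend [] h

end Steps

theorem exists_forall₂_of_forall_mem {α β : Type*} {P : α → Prop} {R : α → β → Prop}
    {l : List β} (h : ∀ b ∈ l, ∃ a, P a ∧ R a b) :
    ∃ l' : List α, (∀ a ∈ l', P a) ∧ List.Forall₂ R l' l := by
  induction l with
  | nil => exact ⟨[], by simp, .nil⟩
  | cons b l ih =>
    rw [List.forall_mem_cons] at h
    obtain ⟨a, ha, hab⟩ := h.1
    obtain ⟨l', hl, hll⟩ := ih h.2
    exact ⟨a :: l', List.forall_mem_cons.2 ⟨ha, hl⟩, .cons hab hll⟩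

theorem Approx.exists_of_rename {ρ : ℕ → ℕ} {n : RPre} {N : Term}
    (h : Approx n (N.rename ρ)) : ∃ n', n = n'.rename ρ ∧ Approx n' N := by
  induction N generalizing n ρ with
  | var i => cases h; exact ⟨RPre.var i, by rw [rename], .var i⟩
  | lam N ih =>
    cases h with
    | lam h => obtain ⟨n, rfl, hn⟩ := ih h; exact ⟨n.lam, by rw [rename], .lam hn⟩
  | app M N ih ih' =>
    cases h with
    | app h h' =>
      obtain ⟨m, rfl, hm⟩ := ih h
      obtain ⟨n, rfl, hn⟩ := ih' h'
      exact ⟨m.app n, by rw [rename], .app hm hn⟩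
  | es M N ih ih' =>
    cases h with
    | es h h' =>
      obtain ⟨m, rfl, hm⟩ := ih h
      obtain ⟨n, rfl, hn⟩ := ih' h'
      exact ⟨m.es n, by rw [rename], .es hm hn⟩
  | der N ih =>
    cases h with
    | der h => obtain ⟨n, rfl, hn⟩ := ih h; exact ⟨n.der, by rw [rename], .der hn⟩
  | bang N ih =>
    cases h with
    | bag h =>
      obtain ⟨l, hl, hll⟩ := exists_forall₂_of_forall_mem (P := (Approx · N))
        (R := fun a b => a.rename ρ = b) fun m hm =>
          let ⟨n, hn, h'⟩ := ih (h m hm); ⟨n, h', hn.symm⟩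
      refine ⟨RPre.bag l, ?_, .bag hl⟩
      rw [rename]
      congr 1
      exact (List.forall₂_eq_eq_eq ▸ List.forall₂_map_left_iff.2 hll : _ = _).symm

theorem exists_map_rename {ρ : ℕ → ℕ} {ps : List RPre} {N : Term}
    (h : ∀ p ∈ ps, Approx p (N.rename ρ)) :
    ∃ qs : List RPre, ps = qs.map (rename ρ) ∧ ∀ q ∈ qs, Approx q N := by
  -- Packing the list into a bag treats all its elements at once.
  obtain ⟨m, hm, h'⟩ := Approx.exists_of_rename (N := Term.bang N) (Approx.bag h)
  cases h' with
  | @bag qs _ h' => rw [rename, RPre.bag.injEq] at hm; exact ⟨qs, hm, h'⟩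

/-- Inverse of linear substitution: the parts of `m'` lying over the copies of `σ x` are cut out, in
left-to-right order, and form `ps`. -/
theorem Approx.exists_linSub {x : ℕ} {σ : ℕ → Term} (hσ : Term.IsInst x σ) {m' : RPre}
    {M : Term} (h : Approx m' (M.subst σ)) :
    ∃ m ps, Approx m M ∧ (∀ p ∈ ps, Approx p (σ x)) ∧ LinSub x ps m m' := by
  induction M generalizing m' x σ with
  | var i =>
    rw [Term.subst] at h
    rcases lt_trichotomy i x with hi | rfl | hi
    · rw [hσ.1 i hi] at h; cases h
      exact ⟨_, [], .var i, by simp, .varLt hi⟩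
    · exact ⟨_, [m'], .var i, by simpa using h, .varEq i m'⟩
    · obtain ⟨j, rfl⟩ : ∃ j, i = j + 1 := ⟨i - 1, by omega⟩
      rw [hσ.2 j (by omega)] at h; cases h
      exact ⟨_, [], .var _, by simp, .varGt (by omega)⟩
  | lam M ih =>
    cases h with
    | lam h =>
      obtain ⟨m, ps, hm, hps, hs⟩ := ih hσ.liftSub h
      obtain ⟨qs, rfl, hqs⟩ := exists_map_rename hps
      exact ⟨_, qs, .lam hm, hqs, .lam hs⟩
  | app M N ih ih' =>
    cases h with
    | app h h' =>
      obtain ⟨m, ps, hm, hps, hs⟩ := ih hσ h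
      obtain ⟨n, qs, hn, hqs, hs'⟩ := ih' hσ h'
      exact ⟨_, ps ++ qs, .app hm hn, List.forall_mem_append.2 ⟨hps, hqs⟩, .app hs hs'⟩
  | es M N ih ih' =>
    cases h with
    | es h h' =>
      obtain ⟨m, ps, hm, hps, hs⟩ := ih hσ.liftSub h
      obtain ⟨ps, rfl, hps'⟩ := exists_map_rename hps
      obtain ⟨n, qs, hn, hqs, hs'⟩ := ih' hσ h'
      exact ⟨_, ps ++ qs, .es hm hn, List.forall_mem_append.2 ⟨hps', hqs⟩, .es hs hs'⟩
  | der M ih =>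
    cases h with
    | der h =>
      obtain ⟨m, ps, hm, hps, hs⟩ := ih hσ h
      exact ⟨_, ps, .der hm, hps, .der hs⟩
  | bang M ih =>
    cases h with
    | @bag ms' _ h =>
      suffices ∃ ms ps, (∀ m ∈ ms, Approx m M) ∧ (∀ p ∈ ps, Approx p (σ x)) ∧
          LinSub x ps (RPre.bag ms) (RPre.bag ms') from
        let ⟨ms, ps, hm, hps, hs⟩ := this; ⟨_, ps, .bag hm, hps, hs⟩
      induction ms' with
      | nil => exact ⟨[], [], by simp, by simp, .bagNil x⟩
      | cons m' ms' ihs =>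
        rw [List.forall_mem_cons] at h
        obtain ⟨m, ps, hm, hps, hs⟩ := ih hσ h.1
        obtain ⟨ms, qs, hms, hqs, hs'⟩ := ihs h.2
        exact ⟨_, ps ++ qs, List.forall_mem_cons.2 ⟨hm, hms⟩,
          List.forall_mem_append.2 ⟨hps, hqs⟩, .bagCons hs hs'⟩

/-- Each root rule needs one resource step. Several may be needed under `!`, one sequence per
element of the bag, and none if the bag is empty. -/
theorem Approx.exists_of_step {M N : Term} (s : Term.Step M N) {n : RPre} (h : Approx n N) :
    ∃ m, Approx m M ∧ Steps m n := by
  induction s generalizing n with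
  | beta L M N =>
    obtain ⟨l, _, rfl, hl, h⟩ := h.exists_plug
    cases h with
    | es hm hn =>
      obtain ⟨n, rfl, hn'⟩ := hn.exists_of_rename
      rw [← hl.length_eq]
      exact ⟨_, .app (.plug hl (.lam hm)) hn', .single (.beta l _ n)⟩
  | sub L M N =>
    obtain ⟨l, m', rfl, hl, h⟩ := h.exists_plug
    rw [Term.subst_instBelow] at h
    obtain ⟨m, ps, hm, hps, hs⟩ := h.exists_linSub (Term.isInst_instBelow N)
    obtain ⟨m, rfl, hm'⟩ := hm.exists_of_rename
    rw [← hl.length_eq] at hs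
    -- The bag is listed in the order of the occurrences, so the identity permutation suffices.
    exact ⟨_, .es hm' (.plug hl (.bag hps)), .single (.sub l (.refl ps) hs)⟩
  | derBang L M =>
    obtain ⟨l, m, rfl, hl, h⟩ := h.exists_plug
    exact ⟨_, .der (.plug hl (.bag (by simpa using h))), .single (.derBag l m)⟩
  | lam _ ih =>
    cases h with | lam h => obtain ⟨m, hm, s⟩ := ih h; exact ⟨_, .lam hm, s.lam⟩
  | appLeft N _ ih =>
    cases h with | app h h' => obtain ⟨m, hm, s⟩ := ih h; exact ⟨_, .app hm h', s.appLeft _⟩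
  | appRight M _ ih =>
    cases h with | app h h' => obtain ⟨m, hm, s⟩ := ih h'; exact ⟨_, .app h hm, s.appRight _⟩
  | esLeft N _ ih =>
    cases h with | es h h' => obtain ⟨m, hm, s⟩ := ih h; exact ⟨_, .es hm h', s.esLeft _⟩
  | esRight M _ ih =>
    cases h with | es h h' => obtain ⟨m, hm, s⟩ := ih h'; exact ⟨_, .es h hm, s.esRight _⟩
  | bang _ ih =>
    cases h with
    | bag h =>
      obtain ⟨ms, hms, s⟩ := exists_forall₂_of_forall_mem fun m hm => ih (h m hm)
      exact ⟨_, .bag hms, .bag s⟩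
  | der _ ih =>
    cases h with | der h => obtain ⟨m, hm, s⟩ := ih h; exact ⟨_, .der hm, s.der⟩

theorem Approx.exists_of_steps {M N : Term} (s : Term.Steps M N) {n : RPre}
    (h : Approx n N) : ∃ m, Approx m M ∧ Steps m n := by
  induction s generalizing n with
  | refl => exact ⟨n, h, .refl n⟩
  | tail _ s ih =>
    obtain ⟨m, hm, t⟩ := h.exists_of_step s
    obtain ⟨m', hm', t'⟩ := ih hm
    exact ⟨m', hm', t'.trans t⟩

end RPre

namespace PTerm

/-! ### Böhm approximants and normal forms -/

theorem Approx.permEq_iff {m n : RPre} (h : RPre.PermEq m n) (A : PTerm) :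
    Approx m A ↔ Approx n A := by
  induction h generalizing A with
  | refl => rfl
  | symm _ ih => exact (ih A).symm
  | trans _ _ ih ih' => exact (ih A).trans (ih' A)
  | lam _ ih =>
    refine ⟨fun h => ?_, fun h => ?_⟩
    · cases h with | lam h => exact .lam ((ih _).1 h)
    · cases h with | lam h => exact .lam ((ih _).2 h)
  | app _ _ ih ih' =>
    refine ⟨fun h => ?_, fun h => ?_⟩
    · cases h with | app h h' => exact .app ((ih _).1 h) ((ih' _).1 h')
    · cases h with | app h h' => exact .app ((ih _).2 h) ((ih' _).2 h')
  | es _ _ ih ih' =>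
    refine ⟨fun h => ?_, fun h => ?_⟩
    · cases h with | es h h' => exact .es ((ih _).1 h) ((ih' _).1 h')
    · cases h with | es h h' => exact .es ((ih _).2 h) ((ih' _).2 h')
  | der _ ih =>
    refine ⟨fun h => ?_, fun h => ?_⟩
    · cases h with | der h => exact .der ((ih _).1 h)
    · cases h with | der h => exact .der ((ih _).2 h)
  | @bagCons m m' ms ms' _ _ ih ih' =>
    have key : ∀ B, (∀ a ∈ ms, Approx a B) ↔ ∀ a ∈ ms', Approx a B := fun B =>
      ⟨fun h => by cases (ih' (bang B)).1 (.bag h) with | bag h => exact h,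
        fun h => by cases (ih' (bang B)).2 (.bag h) with | bag h => exact h⟩
    refine ⟨fun h => ?_, fun h => ?_⟩
    · cases h with
      | @bag _ B h =>
        rw [List.forall_mem_cons, ih, key] at h; exact .bag (List.forall_mem_cons.2 h)
    · cases h with
      | @bag _ B h =>
        rw [List.forall_mem_cons, ← ih, ← key] at h; exact .bag (List.forall_mem_cons.2 h)
  | bagSwap m n ms =>
    refine ⟨fun h => ?_, fun h => ?_⟩ <;> cases h with
    | bag h =>
      simp only [List.forall_mem_cons] at h
      exact .bag (by simpa only [List.forall_mem_cons] using and_left_comm.1 h)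

theorem Approx.of_below {a : RPre} {A : PTerm} {N : Term} (h : Approx a A) (hA : A.Below N) :
    RPre.Approx a N := by
  induction h generalizing N with
  | var i => cases hA; exact .var i
  | lam _ ih => cases hA with | lam h => exact .lam (ih h)
  | app _ _ ih ih' => cases hA with | app h h' => exact .app (ih h) (ih' h')
  | es _ _ ih ih' => cases hA with | es h h' => exact .es (ih h) (ih' h')
  | der _ ih => cases hA with | der h => exact .der (ih h)
  | bag _ ih => cases hA with | bang h => exact .bag fun m hm => ih m hm h

theorem not_approx_plug_lam {l : List RPre} {m : RPre} {A : PTerm} (hA : A.IsApproxNoLam) :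
    ¬ Approx (RPre.plug l (RPre.lam m)) A := by
  intro h
  induction l generalizing A with
  | nil => cases h; simp [IsApproxNoLam] at hA
  | cons n l ih => cases h with | es h _ => rw [IsApproxNoLam] at hA; exact ih hA.1 h

theorem not_approx_plug_bag {l ps : List RPre} {A : PTerm} (hA : A.IsApproxNoBang) :
    ¬ Approx (RPre.plug l (RPre.bag ps)) A := by
  intro h
  induction l generalizing A with
  | nil => cases h; simp [IsApproxNoBang] at hA
  | cons n l ih => cases h with | es h _ => rw [IsApproxNoBang] at hA; exact ih hA.1 h

theorem isApprox_of_noLam {A : PTerm} (h : A.IsApproxNoLam) : A.IsApprox := by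
  induction A <;> simp_all [IsApprox, IsApproxNoLam]

theorem isApprox_of_noBang {A : PTerm} (h : A.IsApproxNoBang) : A.IsApprox := by
  induction A <;> simp_all [IsApprox, IsApproxNoBang]

/-- A redex in `a` would put an abstraction or a bag, below a list context, where the grammar of `A`
forbids its counterpart. -/
theorem Approx.not_step {a b : RPre} (s : RPre.Step a b) {A : PTerm} (hA : A.IsApprox) :
    ¬ Approx a A := by
  intro h
  induction s generalizing A with
  | beta l m n =>
    cases h with | app h _ => rw [IsApprox] at hA; exact not_approx_plug_lam hA.1 h
  | sub l _ _ =>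
    cases h with | es _ h => rw [IsApprox] at hA; exact not_approx_plug_bag hA.2 h
  | derBag l m =>
    cases h with | der h => rw [IsApprox] at hA; exact not_approx_plug_bag hA h
  | lam _ ih => cases h with | lam h => rw [IsApprox] at hA; exact ih hA h
  | appLeft _ _ ih =>
    cases h with | app h _ => rw [IsApprox] at hA; exact ih (isApprox_of_noLam hA.1) h
  | appRight _ _ ih => cases h with | app _ h => rw [IsApprox] at hA; exact ih hA.2 h
  | esLeft _ _ ih => cases h with | es h _ => rw [IsApprox] at hA; exact ih hA.1 h
  | esRight _ _ ih =>
    cases h with | es _ h => rw [IsApprox] at hA; exact ih (isApprox_of_noBang hA.2) h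
  | der _ ih => cases h with | der h => rw [IsApprox] at hA; exact ih (isApprox_of_noBang hA) h
  | bag _ _ _ ih =>
    cases h with | bag h => rw [IsApprox] at hA; exact ih hA (h _ (by simp))

theorem Approx.not_vanish {a : RPre} (s : RPre.Vanish a) {A : PTerm} (hA : A.IsApprox) :
    ¬ Approx a A := by
  intro h
  induction s generalizing A with
  | sub l m ps _ =>
    cases h with | es _ h => rw [IsApprox] at hA; exact not_approx_plug_bag hA.2 h
  | derBag l ms _ =>
    cases h with | der h => rw [IsApprox] at hA; exact not_approx_plug_bag hA h
  | lam _ ih => cases h with | lam h => rw [IsApprox] at hA; exact ih hA h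
  | appLeft _ _ ih =>
    cases h with | app h _ => rw [IsApprox] at hA; exact ih (isApprox_of_noLam hA.1) h
  | appRight _ _ ih => cases h with | app _ h => rw [IsApprox] at hA; exact ih hA.2 h
  | esLeft _ _ ih => cases h with | es h _ => rw [IsApprox] at hA; exact ih hA.1 h
  | esRight _ _ ih =>
    cases h with | es _ h => rw [IsApprox] at hA; exact ih (isApprox_of_noBang hA.2) h
  | der _ ih => cases h with | der h => rw [IsApprox] at hA; exact ih (isApprox_of_noBang hA) h
  | bag _ _ _ ih =>
    cases h with | bag h => rw [IsApprox] at hA; exact ih hA (h _ (by simp))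

theorem Approx.normal_mk {a : RPre} {A : PTerm} (h : Approx a A) (hA : A.IsApprox) :
    (RTerm.mk a).Normal := by
  refine ⟨?_, ?_⟩
  · rintro _ ⟨b, c, hb, _, s⟩
    exact not_step s hA ((permEq_iff (Quotient.exact hb) A).2 h)
  · rintro ⟨b, hb, s⟩
    exact not_vanish s hA ((permEq_iff (Quotient.exact hb) A).2 h)

/-- An approximant leaves this class only by having `⊥` or an abstraction below a list context; the
former has no resource approximant and `ha` rules out the latter. -/
theorem Approx.isApproxNoLam {a : RPre} {A : PTerm} (h : Approx a A) (hA : A.IsApprox)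
    (ha : ∀ l m, a ≠ RPre.plug l (RPre.lam m)) : A.IsApproxNoLam := by
  induction h with
  | var i => simp [IsApproxNoLam]
  | lam _ _ => exact absurd rfl (ha [] _)
  | app _ _ _ _ => simpa [IsApproxNoLam, IsApprox] using hA
  | es _ _ ih _ =>
    rw [IsApprox] at hA
    rw [IsApproxNoLam]
    exact ⟨ih hA.1 fun l m e => ha (_ :: l) m (by rw [e, RPre.plug]), hA.2⟩
  | der _ _ => simpa [IsApproxNoLam, IsApprox] using hA
  | bag _ _ => simpa [IsApproxNoLam, IsApprox] using hA

theorem Approx.isApproxNoBang {a : RPre} {A : PTerm} (h : Approx a A) (hA : A.IsApprox)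
    (ha : ∀ l ps, a ≠ RPre.plug l (RPre.bag ps)) : A.IsApproxNoBang := by
  induction h with
  | var i => simp [IsApproxNoBang]
  | lam _ _ => simpa [IsApproxNoBang, IsApprox] using hA
  | app _ _ _ _ => simpa [IsApproxNoBang, IsApprox] using hA
  | es _ _ ih _ =>
    rw [IsApprox] at hA
    rw [IsApproxNoBang]
    exact ⟨ih hA.1 fun l m e => ha (_ :: l) m (by rw [e, RPre.plug]), hA.2⟩
  | der _ _ => simpa [IsApproxNoBang, IsApprox] using hA
  | bag _ _ => exact absurd rfl (ha [] _)

open Classical in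
/-- The greatest Böhm approximant of a term. -/
noncomputable def ofTerm : Term → PTerm
  | .var i => var i
  | .lam M => lam (ofTerm M)
  | .app M N => if (ofTerm M).IsApproxNoLam then app (ofTerm M) (ofTerm N) else bot
  | .es M N => if (ofTerm N).IsApproxNoBang then es (ofTerm M) (ofTerm N) else bot
  | .bang M => bang (ofTerm M)
  | .der M => if (ofTerm M).IsApproxNoBang then der (ofTerm M) else bot

theorem isApprox_ofTerm (M : Term) : (ofTerm M).IsApprox := by
  induction M <;> rw [ofTerm] <;> (try split_ifs) <;> simp_all [IsApprox]

theorem ofTerm_below (M : Term) : (ofTerm M).Below M := by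
  induction M with
  | var i => exact .var i
  | lam M ih => exact .lam ih
  | app M N ih ih' => rw [ofTerm]; split_ifs; exacts [.app ih ih', .bot _]
  | es M N ih ih' => rw [ofTerm]; split_ifs; exacts [.es ih ih', .bot _]
  | bang M ih => exact .bang ih
  | der M ih => rw [ofTerm]; split_ifs; exacts [.der ih, .bot _]

/-- At every position that `a` inspects, normality makes the test in `ofTerm` succeed; the cuts to
`⊥` lie only below empty bags of `a`. -/
theorem approx_ofTerm {a : RPre} {M : Term} (h : RPre.Approx a M) (ha : a.Normal) :
    Approx a (ofTerm M) := by
  induction h with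
  | var i => exact .var i
  | lam _ ih => exact .lam (ih ha.lam)
  | app _ _ ih ih' =>
    rw [ofTerm, if_pos ((ih ha.appLeft).isApproxNoLam (isApprox_ofTerm _) ha.app_ne)]
    exact .app (ih ha.appLeft) (ih' ha.appRight)
  | es _ _ ih ih' =>
    rw [ofTerm, if_pos ((ih' ha.esRight).isApproxNoBang (isApprox_ofTerm _) ha.es_ne)]
    exact .es (ih ha.esLeft) (ih' ha.esRight)
  | der _ ih =>
    rw [ofTerm, if_pos ((ih ha.der).isApproxNoBang (isApprox_ofTerm _) ha.der_ne)]
    exact .der (ih ha.der)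
  | bag _ ih => exact .bag fun m hm => ih m hm (ha.bag hm)

end PTerm

-- Passage to multiset bags, and the commutation theorem

theorem RPre.Steps.mk {a b : RPre} (s : RPre.Steps a b) :
    RTerm.Steps (RTerm.mk a) (RTerm.mk b) :=
  Relation.ReflTransGen.lift RTerm.mk (fun a b s => ⟨a, b, rfl, rfl, s⟩) _ _ s

theorem RTerm.Normal.of_mk {a : RPre} (h : (RTerm.mk a).Normal) : a.Normal :=
  ⟨fun b s => h.1 _ ⟨a, b, rfl, rfl, s⟩, fun v => h.2 ⟨a, rfl, v⟩⟩

/-- Each step in the quotient may choose new representatives, so the invariant is carried for all of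
them, using invariance under `PermEq`. -/
theorem RPre.WApprox.of_mk_steps {m n : RTerm} (s : RTerm.Steps m n) {M : Term}
    (h : ∀ a, RTerm.mk a = m → RPre.WApprox a M) (b : RPre) (hb : RTerm.mk b = n) :
    RPre.WApprox b M := by
  induction s generalizing b with
  | refl => exact h b hb
  | tail _ s ih =>
    obtain ⟨c, d, hc, hd, s⟩ := s
    exact (permEq_iff (Quotient.exact (hd.trans hb.symm)) M).1 ((ih c hc).step s)

end DBang

/-- Commutation theorem for dBang: `T(BT(M)) = nf(T(M))`. -/
theorem mainTheorem1 (M : DBang.Term) :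
    DBang.taylorTree (DBang.bohmTree M) = DBang.nf (DBang.taylor M) := by
  open DBang in
  ext n
  simp only [taylorTree, bohmTree, nf, taylor, PTerm.taylor, Set.mem_iUnion, Set.mem_ofPred_eq,
    exists_prop]
  constructor
  · rintro ⟨A, ⟨hA, N, s, hAN⟩, a, rfl, ha⟩
    obtain ⟨m, hm, t⟩ := (ha.of_below hAN).exists_of_steps s
    exact ⟨ha.normal_mk hA, _, ⟨m, rfl, hm⟩, t.mk⟩
  · rintro ⟨hn, _, ⟨a, rfl, ha⟩, s⟩
    obtain ⟨b, rfl⟩ := Quotient.exists_rep n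
    have hb : b.Normal := RTerm.Normal.of_mk hn
    have hw := RPre.WApprox.of_mk_steps s
      (fun c hc => (RPre.WApprox.permEq_iff (Quotient.exact hc) M).2 ha.wApprox) b rfl
    obtain ⟨N, t, h⟩ := hw.exists_approx hb
    exact ⟨PTerm.ofTerm N, ⟨PTerm.isApprox_ofTerm N, N, t, PTerm.ofTerm_below N⟩, b, rfl,
      PTerm.approx_ofTerm h hb⟩
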